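/- **Theorem 2.5.** The energy $\mathcal E(G)$ of a finite simple graph $G$ is the sum of the absolute values of the eigenvalues of its adjacency matrix, counted with multiplicity. The clique-inserted graph $C(G)$ of $G$ is the line graph of the subdivision graph of $G$; equivalently, every vertex of $G$ is replaced by a complete graph on its half-edges, and every edge of $G$ is kept as the edge of $C(G)$ joining its two half-edges. Let $H^t(n,m)$ be the toroidal hexagonal lattice: it has white vertices $w_{i,j}$ and black vertices $u_{i,j}$ with $i\in\mathbb Z/(n+1)$ and $j\in\mathbb Z/(m+1)$, and $w_{i,j}$ is adjacent to $u_{i,j}$, $u_{i+1,j}$ and $u_{i,j+1}$. Its boundary edges are the $m+1$ edges $(a_j,a_j^*)=(w_{n,j},u_{0,j})$ and the $n+1$ edges $(b_i,b_i^*)=(w_{i,m},u_{i,0})$. The 3-12-12 lattice is $T^t(n,m)=C(H^t(n,m))$, and the 3-6-24 lattice with toroidal boundary condition is $S^t(n,m)=C(T^t(n,m))$. Every edge of $H^t(n,m)$ is kept as an edge of $T^t(n,m)$, and thus of $S^t(n,m)$. Deleting the edges $(b_i,b_i^*)$ from $S^t(n,m)$ gives the 3-6-24 lattice $S^c(n,m)$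 with cylindrical boundary condition, and deleting in addition the edges $(a_j,a_j^*)$ gives the 3-6-24 lattice $S^f(n,m)$ with free boundary condition. Then, as $n$ and $m$ tend to infinity jointly (and independently of each other), $$\lim_{n,m\to\infty}\frac{\mathcal E(S^t(n,m))}{18mn}=\lim_{n,m\to\infty}\frac{\mathcal E(S^c(n,m))}{18mn}=\lim_{n,m\to\infty}\frac{\mathcal E(S^f(n,m))}{18mn}=L,$$ where, with $q(x,y)=\sqrt{3+2\cos x+2\cos y+2\cos(x+y)}$, $$L=\frac1{72\pi^2}\int_0^{2\pi}\!\int_0^{2\pi}\Big(\sqrt{15+2\sqrt{13+4q(x,y)}}+\sqrt{15+2\sqrt{13-4q(x,y)}}+\sqrt{15-2\sqrt{13+4q(x,y)}}+\sqrt{15-2\sqrt{13-4q(x,y)}}\Big)\,dx\,dy+\frac{\sqrt5+\sqrt{13}+6}{18},$$ and $L\approx1.4908$, in the sense that $|L-1.4908|<5\cdot10^{-5}$. -/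

import Mathlib

open Filter Topology

/-- The subdivision graph `S(G)`: a new vertex is inserted into every edge of `G`, i.e. the vertices
are those of `G` together with the edges of `G`, and `v` is joined to `e` when `v` is an end
of `e`. -/
def subdivisionGraph {V : Type*} (G : SimpleGraph V) : SimpleGraph (V ⊕ G.edgeSet) where
  Adj x y := (∃ (v : V) (e : G.edgeSet), v ∈ (e : Sym2 V) ∧ x = Sum.inl v ∧ y = Sum.inr e) ∨
    (∃ (v : V) (e : G.edgeSet), v ∈ (e : Sym2 V) ∧ y = Sum.inl v ∧ x = Sum.inr e)
  symm.symm _ _ h := h.symm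
  loopless.irrefl x h := by
    rcases h with ⟨v, e, -, h1, h2⟩ | ⟨v, e, -, h1, h2⟩ <;> simp [h1] at h2

/-- The clique-inserted graph `C(G)`: every vertex `v` of `G` is replaced by a complete graph, whose
vertices are the darts (half-edges) of `G` starting at `v`, and every edge `{u, v}` of `G` is kept,
as the edge joining its two half-edges `(u, v)` and `(v, u)`. -/
def cliqueInserted {V : Type*} (G : SimpleGraph V) : SimpleGraph G.Dart where
  Adj d d' := d ≠ d' ∧ (d.fst = d'.fst ∨ d' = d.symm)
  symm.symm d d' h := by
    refine ⟨h.1.symm, h.2.imp Eq.symm ?_⟩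
    rintro rfl
    exact d.symm_symm.symm
  loopless.irrefl _ h := h.1 rfl

instance {V : Type*} [DecidableEq V] (G : SimpleGraph V) : DecidableRel (cliqueInserted G).Adj :=
  fun d d' => inferInstanceAs (Decidable (d ≠ d' ∧ (d.fst = d'.fst ∨ d' = d.symm)))

/-- The clique-inserted graph is the line graph of the subdivision graph. -/
theorem cliqueInserted_iso_lineGraph_subdivisionGraph {V : Type*} (G : SimpleGraph V) :
    Nonempty (cliqueInserted G ≃g (subdivisionGraph G).lineGraph) := by
  let f : G.Dart → (subdivisionGraph G).edgeSet := fun d =>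
    ⟨s(Sum.inl d.fst, Sum.inr ⟨d.edge, d.edge_mem⟩),
      Or.inl ⟨d.fst, ⟨d.edge, d.edge_mem⟩, by simp [SimpleGraph.Dart.edge], rfl, rfl⟩⟩
  have key : ∀ d d' : G.Dart, d.fst = d'.fst → d.edge = d'.edge → d = d' := by
    intro d d' h1 h2
    rcases (SimpleGraph.dart_edge_eq_iff d d').1 h2 with h | h
    · exact h
    · subst h
      exact absurd h1 (by simp)
  have hinj : Function.Injective f := by
    intro d d' h
    have h' := congrArg Subtype.val h
    simp only [f, Sym2.eq_iff, Sum.inl.injEq, Sum.inr.injEq, Subtype.mk.injEq, reduceCtorEq,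
      and_self, or_false] at h'
    exact key d d' h'.1 h'.2
  have hsurj : Function.Surjective f := by
    have aux : ∀ (v : V) (e : G.edgeSet), v ∈ (e : Sym2 V) → ∃ d : G.Dart,
        (s(Sum.inl d.fst, Sum.inr ⟨d.edge, d.edge_mem⟩) : Sym2 (V ⊕ G.edgeSet)) =
          s(Sum.inl v, Sum.inr e) := by
      rintro v ⟨e, he⟩ hv
      obtain ⟨w, rfl⟩ := Sym2.mem_iff_exists.1 hv
      exact ⟨⟨(v, w), he⟩, rfl⟩
    rintro ⟨e, he⟩
    induction e using Sym2.ind with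
    | _ x y =>
      rcases he with ⟨v, e, hv, hx, hy⟩ | ⟨v, e, hv, hy, hx⟩
      · obtain ⟨d, hd⟩ := aux v e hv
        exact ⟨d, Subtype.ext (hd.trans (congrArg₂ (fun a b => s(a, b)) hx.symm hy.symm))⟩
      · obtain ⟨d, hd⟩ := aux v e hv
        exact ⟨d, Subtype.ext ((hd.trans Sym2.eq_swap).trans
          (congrArg₂ (fun a b => s(a, b)) hx.symm hy.symm))⟩
  refine ⟨⟨Equiv.ofBijective f ⟨hinj, hsurj⟩, ?_⟩⟩
  intro d d'
  rw [SimpleGraph.lineGraph_adj_iff_exists]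
  change (f d ≠ f d' ∧ ∃ v, v ∈ (f d).1 ∧ v ∈ (f d').1) ↔ d ≠ d' ∧ (d.fst = d'.fst ∨ d' = d.symm)
  refine and_congr hinj.ne_iff ?_
  constructor
  · rintro ⟨x, hx, hx'⟩
    simp only [f, Sym2.mem_iff] at hx hx'
    rcases hx with rfl | rfl
    · simp only [Sum.inl.injEq, reduceCtorEq, or_false] at hx'
      exact Or.inl hx'
    · simp only [Sum.inr.injEq, Subtype.mk.injEq, reduceCtorEq, false_or] at hx'
      rcases (SimpleGraph.dart_edge_eq_iff d d').1 hx' with h | h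
      · exact Or.inl (by rw [h])
      · exact Or.inr (by rw [h, SimpleGraph.Dart.symm_symm])
  · rintro (h | rfl)
    · exact ⟨Sum.inl d.fst, by simp [f], by simp [f, h]⟩
    · exact ⟨Sum.inr ⟨d.edge, d.edge_mem⟩, by simp [f], by simp [f]⟩

/-- A set `s` of edges of `G`, regarded as a set of edges of `C(G)`: the edge `{u, v}` of `G`
becomes the edge of `C(G)` joining the half-edges `(u, v)` and `(v, u)`. -/
def keptEdges {V : Type*} (G : SimpleGraph V) (s : Set (Sym2 V)) : Set (Sym2 G.Dart) :=
  {e | ∃ d : G.Dart, d.edge ∈ s ∧ e = s(d, d.symm)}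

/-- The energy of a finite graph: the sum of the absolute values of the eigenvalues (with
multiplicity) of its adjacency matrix. -/
noncomputable def graphEnergy {V : Type*} [Fintype V] (G : SimpleGraph V) : ℝ :=
  open Classical in
  ∑ i, |(G.isHermitian_adjMatrix ℝ).eigenvalues i|

/-- The vertices of the toroidal hexagonal lattice: an `(n + 1) × (m + 1)` array of unit cells
with two vertices each, a white one (`false`) and a black one (`true`). Cells are indexed cyclically
in both directions. -/
abbrev HexVertex (n m : ℕ) : Type := Bool × ZMod (n + 1) × ZMod (m + 1)

/-- The white vertex of cell `p` is joined to the black vertices of the cells `p`, `p + (1, 0)` and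
`p + (0, 1)`. -/
def hexLink {n m : ℕ} (p q : ZMod (n + 1) × ZMod (m + 1)) : Prop :=
  q = p ∨ q = (p.1 + 1, p.2) ∨ q = (p.1, p.2 + 1)

instance {n m : ℕ} (p q : ZMod (n + 1) × ZMod (m + 1)) : Decidable (hexLink p q) :=
  inferInstanceAs (Decidable (_ ∨ _ ∨ _))

/-- The hexagonal lattice `H^t(n, m)` with toroidal boundary condition. -/
def hexToroidal (n m : ℕ) : SimpleGraph (HexVertex n m) where
  Adj u v := (u.1 = false ∧ v.1 = true ∧ hexLink u.2 v.2) ∨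
    (v.1 = false ∧ u.1 = true ∧ hexLink v.2 u.2)
  symm.symm _ _ h := h.symm
  loopless.irrefl u h := by
    rcases h with ⟨h1, h2, -⟩ | ⟨h1, h2, -⟩ <;> simp [h1] at h2

instance (n m : ℕ) : DecidableRel (hexToroidal n m).Adj :=
  fun u v => inferInstanceAs (Decidable ((u.1 = false ∧ v.1 = true ∧ hexLink u.2 v.2) ∨
    (v.1 = false ∧ u.1 = true ∧ hexLink v.2 u.2)))

/-- The `m + 1` boundary edges `(a_j, a_j^*)` of `H^t(n, m)`, which wrap around in the first
direction: they lead from the last cell (of index `-1`, which is `n`) to the first one. -/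
def hexSeamA (n m : ℕ) : Set (Sym2 (HexVertex n m)) :=
  {e | ∃ j : ZMod (m + 1), e = s((false, -1, j), (true, 0, j))}

/-- The `n + 1` boundary edges `(b_i, b_i^*)` of `H^t(n, m)`, which wrap around in the second
direction: they lead from the last cell (of index `-1`, which is `m`) to the first one. -/
def hexSeamB (n m : ℕ) : Set (Sym2 (HexVertex n m)) :=
  {e | ∃ i : ZMod (n + 1), e = s((false, i, -1), (true, i, 0))}

/-- The 3-12-12 lattice `T^t(n, m) = C(H^t(n, m))` with toroidal boundary condition. -/
abbrev lattice31212Toroidal (n m : ℕ) : SimpleGraph (hexToroidal n m).Dart :=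
  cliqueInserted (hexToroidal n m)

/-- The 3-6-24 lattice `S^t(n, m) = C(T^t(n, m))` with toroidal boundary condition. -/
abbrev lattice3624Toroidal (n m : ℕ) : SimpleGraph (lattice31212Toroidal n m).Dart :=
  cliqueInserted (lattice31212Toroidal n m)

/-- The 3-6-24 lattice `S^c(n, m)` with cylindrical boundary condition: the edges `(b_i, b_i^*)`
are deleted from `S^t(n, m)`. -/
def lattice3624Cylindrical (n m : ℕ) : SimpleGraph (lattice31212Toroidal n m).Dart :=
  (lattice3624Toroidal n m).deleteEdges
    (keptEdges (lattice31212Toroidal n m) (keptEdges (hexToroidal n m) (hexSeamB n m)))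

/-- The 3-6-24 lattice `S^f(n, m)` with free boundary condition: the edges `(a_j, a_j^*)`
are deleted from `S^c(n, m)`. -/
def lattice3624Free (n m : ℕ) : SimpleGraph (lattice31212Toroidal n m).Dart :=
  (lattice3624Cylindrical n m).deleteEdges
    (keptEdges (lattice31212Toroidal n m) (keptEdges (hexToroidal n m) (hexSeamA n m)))

/-- The sum of the absolute values of the entries of a matrix. -/
def Matrix.absSum {V : Type*} [Fintype V] (M : Matrix V V ℝ) : ℝ := ∑ x, ∑ y, |M x y|

namespace Matrix.IsHermitian

variable {V : Type*} [Fintype V] [DecidableEq V] {A : Matrix V V ℝ}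

/-- The squares of the entries of a vector in an orthonormal eigenbasis sum to `1`. -/
theorem sum_sq_eigenvectorBasis (hA : A.IsHermitian) (i : V) :
    ∑ x, hA.eigenvectorBasis i x ^ 2 = 1 := by
  have h := hA.eigenvectorBasis.orthonormal.1 i
  have h2 : ‖hA.eigenvectorBasis i‖ ^ 2 = 1 := by rw [h, one_pow]
  rw [EuclideanSpace.norm_sq_eq] at h2
  simpa using h2

theorem sum_sq_eigenvectorBasis_apply (hA : A.IsHermitian) (x : V) :
    ∑ i, hA.eigenvectorBasis i x ^ 2 = 1 := by
  have h := hA.eigenvectorBasis.sum_sq_norm_inner_right (EuclideanSpace.single x (1 : ℝ))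
  simpa [EuclideanSpace.inner_single_right] using h

theorem eigenvalues_eq_dotProduct (hA : A.IsHermitian) (i : V) :
    hA.eigenvalues i = (hA.eigenvectorBasis i).ofLp ⬝ᵥ (A *ᵥ (hA.eigenvectorBasis i).ofLp) := by
  rw [hA.mulVec_eigenvectorBasis i, dotProduct_smul]
  have h := hA.sum_sq_eigenvectorBasis i
  have : (hA.eigenvectorBasis i).ofLp ⬝ᵥ (hA.eigenvectorBasis i).ofLp = 1 := by
    simpa [dotProduct, sq] using h
  rw [this]; simp

/-- The quadratic form of a symmetric matrix in terms of its eigenvalues. -/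
theorem dotProduct_mulVec_eq_sum (hA : A.IsHermitian) (v : EuclideanSpace ℝ V) :
    v.ofLp ⬝ᵥ (A *ᵥ v.ofLp) =
      ∑ j, hA.eigenvalues j * (inner ℝ (hA.eigenvectorBasis j) v) ^ 2 := by
  set b := hA.eigenvectorBasis with hb
  have h1 : v.ofLp ⬝ᵥ (A *ᵥ v.ofLp) = inner ℝ v (WithLp.toLp 2 (A *ᵥ v.ofLp)) := by
    rw [EuclideanSpace.inner_eq_star_dotProduct, dotProduct_comm]; simp
  rw [h1, ← b.sum_inner_mul_inner]
  refine Finset.sum_congr rfl fun j _ => ?_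
  have h2 : inner ℝ (b j) (WithLp.toLp 2 (A *ᵥ v.ofLp)) = hA.eigenvalues j * inner ℝ (b j) v := by
    rw [EuclideanSpace.inner_eq_star_dotProduct, EuclideanSpace.inner_eq_star_dotProduct]
    have h3 : (A *ᵥ v.ofLp) ⬝ᵥ (b j).ofLp = v.ofLp ⬝ᵥ (A *ᵥ (b j).ofLp) := by
      have hAt : Aᵀ = A := conjTranspose_eq_transpose_of_trivial A ▸ hA.eq
      rw [dotProduct_mulVec, ← mulVec_transpose, hAt]
    simp only [star_trivial]
    rw [h3, hb, hA.mulVec_eigenvectorBasis j, dotProduct_smul, smul_eq_mul]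
  rw [h2, real_inner_comm]; ring

theorem sum_abs_dotProduct_mulVec_le (hA : A.IsHermitian)
    (b : OrthonormalBasis V ℝ (EuclideanSpace ℝ V)) :
    ∑ i, |(b i).ofLp ⬝ᵥ (A *ᵥ (b i).ofLp)| ≤ ∑ j, |hA.eigenvalues j| := by
  calc ∑ i, |(b i).ofLp ⬝ᵥ (A *ᵥ (b i).ofLp)|
      ≤ ∑ i, ∑ j, |hA.eigenvalues j| * (inner ℝ (hA.eigenvectorBasis j) (b i)) ^ 2 := by
        refine Finset.sum_le_sum fun i _ => ?_
        rw [hA.dotProduct_mulVec_eq_sum]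
        refine (Finset.abs_sum_le_sum_abs _ _).trans_eq (Finset.sum_congr rfl fun j _ => ?_)
        rw [abs_mul, abs_sq]
    _ = ∑ j, |hA.eigenvalues j| := by
        rw [Finset.sum_comm]
        refine Finset.sum_congr rfl fun j _ => ?_
        rw [← Finset.mul_sum]
        have h := b.sum_sq_norm_inner_right (hA.eigenvectorBasis j)
        rw [hA.eigenvectorBasis.orthonormal.1 j] at h
        have h' : ∑ i, (inner ℝ (hA.eigenvectorBasis j) (b i)) ^ 2 = (1 : ℝ) := by
          refine Eq.trans ?_ (h.trans (one_pow 2))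
          refine Finset.sum_congr rfl fun i _ => ?_
          rw [Real.norm_eq_abs, sq_abs, real_inner_comm]
        rw [h', mul_one]

theorem sum_abs_eigenvectorBasis_dotProduct_mulVec_le (hA : A.IsHermitian) (D : Matrix V V ℝ) :
    ∑ i, |(hA.eigenvectorBasis i).ofLp ⬝ᵥ (D *ᵥ (hA.eigenvectorBasis i).ofLp)| ≤ D.absSum := by
  set b := hA.eigenvectorBasis
  have key : ∀ i, |(b i).ofLp ⬝ᵥ (D *ᵥ (b i).ofLp)| ≤
      ∑ x, ∑ y, |D x y| * ((b i x ^ 2 + b i y ^ 2) / 2) := by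
    intro i
    simp only [dotProduct, mulVec, Finset.mul_sum]
    refine (Finset.abs_sum_le_sum_abs _ _).trans (Finset.sum_le_sum fun x _ => ?_)
    refine (Finset.abs_sum_le_sum_abs _ _).trans (Finset.sum_le_sum fun y _ => ?_)
    rw [abs_mul, abs_mul]
    have h : |(b i) x| * |(b i) y| ≤ (b i x ^ 2 + b i y ^ 2) / 2 := by
      nlinarith [sq_nonneg (|(b i) x| - |(b i) y|), sq_abs ((b i) x), sq_abs ((b i) y)]
    nlinarith [mul_le_mul_of_nonneg_left h (abs_nonneg (D x y))]
  refine (Finset.sum_le_sum fun i _ => key i).trans_eq ?_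
  rw [Finset.sum_comm]
  refine Finset.sum_congr rfl fun x _ => ?_
  rw [Finset.sum_comm]
  refine Finset.sum_congr rfl fun y _ => ?_
  rw [← Finset.mul_sum, ← Finset.sum_div, Finset.sum_add_distrib,
    hA.sum_sq_eigenvectorBasis_apply, hA.sum_sq_eigenvectorBasis_apply]
  norm_num

/-- The trace norm of a symmetric matrix changes by at most the entrywise `ℓ¹` norm of a
perturbation. -/
theorem sum_abs_eigenvalues_le_add {B : Matrix V V ℝ} (hA : A.IsHermitian) (hB : B.IsHermitian) :
    ∑ i, |hA.eigenvalues i| ≤ ∑ i, |hB.eigenvalues i| + (A - B).absSum := by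
  refine le_trans ?_ (add_le_add (hB.sum_abs_dotProduct_mulVec_le hA.eigenvectorBasis)
    (hA.sum_abs_eigenvectorBasis_dotProduct_mulVec_le (A - B)))
  rw [← Finset.sum_add_distrib]
  refine Finset.sum_le_sum fun i _ => ?_
  rw [hA.eigenvalues_eq_dotProduct i]
  refine le_trans (le_of_eq ?_) (abs_add_le _ _)
  rw [← dotProduct_add, ← add_mulVec, add_sub_cancel]

end Matrix.IsHermitian

theorem Matrix.absSum_le_ncard {V : Type*} [Fintype V] (M : Matrix V V ℝ) (r : Set (V × V))
    (h0 : ∀ p ∉ r, M p.1 p.2 = 0) (h1 : ∀ p : V × V, |M p.1 p.2| ≤ 1) : M.absSum ≤ r.ncard := by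
  classical
  have hM : M.absSum = ∑ p : V × V, |M p.1 p.2| :=
    (Fintype.sum_prod_type fun p : V × V => |M p.1 p.2|).symm
  rw [hM, Set.ncard_eq_toFinset_card', Finset.cast_card,
    ← Finset.sum_subset (Finset.subset_univ r.toFinset)]
  · exact Finset.sum_le_sum fun p _ => h1 p
  · intro p _ hp
    rw [h0 p (by simpa using hp), abs_zero]

/-- The energies of two graphs on the same vertices differ by at most the number of ordered pairs
that are adjacent in exactly one of them. -/
theorem graphEnergy_le_add {V : Type*} [Fintype V] (G H : SimpleGraph V) :
    graphEnergy G ≤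
      graphEnergy H + Set.ncard {p : V × V | ¬(G.Adj p.1 p.2 ↔ H.Adj p.1 p.2)} := by
  classical
  refine (Matrix.IsHermitian.sum_abs_eigenvalues_le_add (G.isHermitian_adjMatrix ℝ)
    (H.isHermitian_adjMatrix ℝ)).trans ?_
  refine add_le_add_right (Matrix.absSum_le_ncard _ _ (fun p hp => ?_) fun p => ?_) _
  · have hp' : G.Adj p.1 p.2 ↔ H.Adj p.1 p.2 := not_not.1 hp
    simp [SimpleGraph.adjMatrix_apply, hp']
  · simp only [Matrix.sub_apply, SimpleGraph.adjMatrix_apply]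
    split_ifs <;> simp

/-- Deleting a set of edges changes the energy by at most the number of ordered pairs that form
such an edge. -/
theorem abs_graphEnergy_deleteEdges_sub_le {V : Type*} [Fintype V] (G : SimpleGraph V)
    (s : Set (Sym2 V)) :
    |graphEnergy (G.deleteEdges s) - graphEnergy G| ≤
      Set.ncard {p : V × V | s(p.1, p.2) ∈ s} := by
  have hle : ∀ t : Set (V × V), t ⊆ {p : V × V | s(p.1, p.2) ∈ s} →
      (t.ncard : ℝ) ≤ Set.ncard {p : V × V | s(p.1, p.2) ∈ s} := fun t ht => by
    exact_mod_cast Set.ncard_le_ncard ht (Set.toFinite _)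
  rw [abs_sub_le_iff, sub_le_iff_le_add', sub_le_iff_le_add']
  constructor
  · refine (graphEnergy_le_add _ _).trans (add_le_add_right (hle _ fun p hp => ?_) _)
    by_contra h
    exact hp (by simp_all)
  · refine (graphEnergy_le_add _ _).trans (add_le_add_right (hle _ fun p hp => ?_) _)
    by_contra h
    exact hp (by simp_all)

theorem graphEnergy_eq_of_charpoly {V : Type*} [Fintype V] [DecidableEq V] (G : SimpleGraph V)
    [DecidableRel G.Adj] (s : Multiset ℝ)
    (h : (G.adjMatrix ℝ).charpoly = (s.map fun a => Polynomial.X - Polynomial.C a).prod) :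
    graphEnergy G = (s.map fun a => |a|).sum := by
  classical
  have h1 := (G.isHermitian_adjMatrix ℝ).roots_charpoly_eq_eigenvalues
  have h2 : s = (G.adjMatrix ℝ).charpoly.roots := by
    rw [h, Polynomial.roots_multiset_prod_X_sub_C]
  rw [h2]
  have h3 : (G.adjMatrix ℝ).charpoly.roots = Multiset.map _ Finset.univ.val := h1
  rw [h3, Multiset.map_map, graphEnergy]
  simp only [Finset.sum]
  refine congrArg Multiset.sum (Multiset.map_congr rfl fun i _ => ?_)
  simp only [Function.comp_apply, RCLike.ofReal_real_eq_id, id_eq]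
  congr!

namespace SimpleGraph

variable {V : Type*} [DecidableEq V] (G : SimpleGraph V)

/-- The incidence matrix between darts and their initial vertices. -/
def dartFstMatrix : Matrix G.Dart V ℝ := Matrix.of fun d v => if d.fst = v then 1 else 0

/-- The incidence matrix between darts and the edges supporting them. -/
def dartEdgeMatrix : Matrix G.Dart G.edgeSet ℝ :=
  Matrix.of fun d e => if d.edge = e then 1 else 0

/-- The permutation matrix of the reversal of darts. -/
def dartSymmMatrix : Matrix G.Dart G.Dart ℝ := Matrix.of fun d d' => if d' = d.symm then 1 else 0

open Matrix

theorem adjMatrix_cliqueInserted [Fintype V] :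
    (cliqueInserted G).adjMatrix ℝ =
      G.dartSymmMatrix + G.dartFstMatrix * G.dartFstMatrixᵀ - 1 := by
  ext d d'
  have h1 : d.symm ≠ d := d.symm_ne
  have h2 : d.symm.fst ≠ d.fst := by
    intro h
    exact d.fst_ne_snd h.symm
  have h3 : (cliqueInserted G).Adj d d' ↔ d ≠ d' ∧ (d.fst = d'.fst ∨ d' = d.symm) := Iff.rfl
  simp only [adjMatrix_apply, h3, dartSymmMatrix, dartFstMatrix, Matrix.sub_apply, Matrix.add_apply,
    mul_apply, of_apply, transpose_apply, one_apply]
  simp only [mul_ite, mul_one, mul_zero, Finset.sum_ite_eq, Finset.mem_univ, if_true]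
  by_cases ha : d' = d.symm
  · subst ha
    simp [h1.symm]
  · by_cases hb : d = d'
    · subst hb; simp [h1.symm]
    · by_cases hc : d.fst = d'.fst
      · simp [ha, hb, hc]
      · simp [ha, hb, hc]

variable [Fintype V] [DecidableRel G.Adj]

theorem dartEdgeMatrix_mul_transpose :
    G.dartEdgeMatrix * G.dartEdgeMatrixᵀ = G.dartSymmMatrix + 1 := by
  ext d d'
  have h1 : d.symm ≠ d := d.symm_ne
  have h0 : ∀ e : G.edgeSet, d.edge = e ↔ (⟨d.edge, d.edge_mem⟩ : G.edgeSet) = e :=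
    fun e => by rw [Subtype.ext_iff]
  simp only [dartEdgeMatrix, dartSymmMatrix, mul_apply, of_apply, transpose_apply, Matrix.add_apply,
    one_apply, h0]
  simp only [ite_mul, one_mul, zero_mul, Finset.sum_ite_eq, Finset.mem_univ, if_true]
  have h3 : d'.edge = d.edge ↔ d' = d ∨ d' = d.symm := dart_edge_eq_iff d' d
  simp only [h3]
  by_cases ha : d' = d.symm
  · subst ha; simp [h1.symm]
  · by_cases hb : d' = d
    · subst hb; simp [h1.symm]
    · simp [ha, hb, Ne.symm hb]

theorem transpose_mul_dartEdgeMatrix :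
    G.dartEdgeMatrixᵀ * G.dartEdgeMatrix = (2 : ℝ) • 1 := by
  ext e e'
  simp only [dartEdgeMatrix, mul_apply, of_apply, transpose_apply, Matrix.smul_apply, one_apply]
  by_cases h : e = e'
  · subst h
    have := G.dart_edge_fiber_card e e.2
    simp only [ite_mul, one_mul, zero_mul, if_true]
    simp [Finset.sum_ite, Finset.filter_filter, this]
  · rw [if_neg h, smul_zero]
    refine Finset.sum_eq_zero fun d _ => ?_
    by_cases h2 : d.edge = e
    · rw [if_neg (fun h3 => h (Subtype.ext (h2.symm.trans h3))), mul_zero]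
    · rw [if_neg h2, zero_mul]

theorem dartSymmMatrix_mul_self : G.dartSymmMatrix * G.dartSymmMatrix = 1 := by
  ext d d'
  simp only [dartSymmMatrix, mul_apply, of_apply, one_apply]
  have h : ∀ x : G.Dart, (if x = d.symm then (1 : ℝ) else 0) * (if d' = x.symm then 1 else 0) =
      if x = d.symm then (if d' = d then 1 else 0) else 0 := by
    intro x
    by_cases h : x = d.symm
    · subst h; simp
    · simp [h]
  simp only [h, Finset.sum_ite_eq', Finset.mem_univ, if_true, eq_comm]

theorem transpose_mul_dartFstMatrix {r : ℕ} (hG : G.IsRegularOfDegree r) :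
    G.dartFstMatrixᵀ * G.dartFstMatrix = (r : ℝ) • 1 := by
  ext v w
  simp only [dartFstMatrix, mul_apply, of_apply, transpose_apply, Matrix.smul_apply, one_apply]
  by_cases h : v = w
  · subst h
    have := G.dart_fst_fiber_card_eq_degree v
    rw [hG v] at this
    simp only [ite_mul, one_mul, zero_mul, if_true]
    simp [Finset.sum_ite, Finset.filter_filter, this]
  · rw [if_neg h, smul_zero]
    refine Finset.sum_eq_zero fun d _ => ?_
    by_cases h2 : d.fst = v
    · rw [if_neg (fun h3 => h (h2.symm.trans h3)), mul_zero]
    · rw [if_neg h2, zero_mul]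

theorem transpose_mul_dartSymmMatrix_mul :
    G.dartFstMatrixᵀ * G.dartSymmMatrix * G.dartFstMatrix = G.adjMatrix ℝ := by
  ext v w
  simp only [dartFstMatrix, dartSymmMatrix, mul_apply, of_apply, transpose_apply, adjMatrix_apply,
    Finset.sum_mul]
  have key : ∀ d d' : G.Dart, (((if d'.fst = v then (1 : ℝ) else 0) *
      if d = d'.symm then 1 else 0) * if d.fst = w then 1 else 0) =
      if d' = d.symm then (if d.snd = v ∧ d.fst = w then 1 else 0) else 0 := by
    intro d d'
    by_cases h : d' = d.symm
    · subst h
      by_cases h1 : d.snd = v <;> by_cases h2 : d.fst = w <;> simp [h1, h2]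
    · have : d ≠ d'.symm := fun h' => h (by rw [h', Dart.symm_symm])
      simp [h, this]
  simp only [key, Finset.sum_ite_eq', Finset.mem_univ, if_true]
  by_cases h : G.Adj v w
  · rw [if_pos h, Finset.sum_eq_single (⟨(w, v), h.symm⟩ : G.Dart)]
    · simp
    · rintro d - hd
      refine if_neg fun h' => hd ?_
      ext <;> simp [h']
    · simp
  · rw [if_neg h]
    refine Finset.sum_eq_zero fun d _ => if_neg ?_
    rintro ⟨rfl, rfl⟩
    exact h d.adj.symm

theorem det_smul_one_sub_dartSymmMatrix {y : ℝ} (hy : y + 1 ≠ 0) :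
    (y • (1 : Matrix G.Dart G.Dart ℝ) - G.dartSymmMatrix).det =
      (y ^ 2 - 1) ^ Fintype.card G.edgeSet := by
  have h1 : y • (1 : Matrix G.Dart G.Dart ℝ) - G.dartSymmMatrix =
      (y + 1) • (1 - ((y + 1)⁻¹ • G.dartEdgeMatrix) * G.dartEdgeMatrixᵀ) := by
    rw [Matrix.smul_mul, dartEdgeMatrix_mul_transpose, smul_sub, smul_smul, mul_inv_cancel₀ hy, one_smul,
      add_smul, one_smul]
    abel
  have hcard : Fintype.card G.Dart = 2 * Fintype.card G.edgeSet := by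
    rw [dart_card_eq_twice_card_edges, edgeFinset_card]
  rw [h1, det_smul, det_one_sub_mul_comm, Matrix.mul_smul, transpose_mul_dartEdgeMatrix, smul_smul]
  have h2 : (1 : Matrix G.edgeSet G.edgeSet ℝ) - ((y + 1)⁻¹ * 2) • (1 : Matrix _ _ ℝ) =
      ((y - 1) / (y + 1)) • 1 := by
    rw [show (1 : Matrix G.edgeSet G.edgeSet ℝ) - ((y + 1)⁻¹ * 2) • (1 : Matrix _ _ ℝ) =
      (1 - (y + 1)⁻¹ * 2) • 1 by rw [sub_smul, one_smul]]
    congr 1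
    field_simp
    ring
  rw [h2, det_smul, det_one, mul_one, hcard, pow_mul, ← mul_pow]
  congr 1
  field_simp
  ring

open Polynomial in
/-- The characteristic polynomial of the clique-inserted graph of a regular graph. -/
theorem charpoly_cliqueInserted_mul {r : ℕ} (hG : G.IsRegularOfDegree r) :
    ((cliqueInserted G).adjMatrix ℝ).charpoly * (X ^ 2 + 2 * X) ^ Fintype.card V =
      (X ^ 2 + 2 * X) ^ Fintype.card G.edgeSet *
        (G.adjMatrix ℝ).charpoly.comp (X ^ 2 + (2 - (r : ℝ[X])) * X - (r : ℝ[X])) := by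
  refine eq_of_infinite_eval_eq _ _ (((Set.toFinite {0, -2}).infinite_compl).mono ?_)
  intro x hx
  simp only [Set.mem_compl_iff, Set.mem_insert_iff, Set.mem_singleton_iff, not_or] at hx
  have hx2 : x + 1 + 1 ≠ 0 := fun h => hx.2 (by linarith)
  obtain ⟨y, hy⟩ : ∃ y, y = x + 1 := ⟨_, rfl⟩
  rw [← hy] at hx2
  have hyy : y ^ 2 - 1 ≠ 0 := by
    have : y ^ 2 - 1 = x * (y + 1) := by rw [hy]; ring
    rw [this]
    exact mul_ne_zero hx.1 hx2
  set S := G.dartSymmMatrix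
  set R := G.dartFstMatrix
  set c := (y ^ 2 - 1)⁻¹ with hc
  have hW : (y • 1 - S) * (c • (y • 1 + S)) = 1 := by
    rw [Matrix.mul_smul, sub_mul, mul_add, mul_add, dartSymmMatrix_mul_self]
    simp only [Matrix.smul_mul, Matrix.mul_smul, one_mul, mul_one]
    rw [show y • y • (1 : Matrix G.Dart G.Dart ℝ) + y • S - (y • S + 1) =
      (y ^ 2 - 1) • 1 by rw [smul_smul, sub_smul, one_smul, sq]; abel, smul_smul,
      hc, inv_mul_cancel₀ hyy, one_smul]
  have h1 : (scalar G.Dart) x - (cliqueInserted G).adjMatrix ℝ =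
      (y • 1 - S) * (1 - (c • (y • 1 + S)) * R * Rᵀ) := by
    rw [mul_sub, mul_one, Matrix.mul_assoc, ← Matrix.mul_assoc, hW, Matrix.one_mul,
      adjMatrix_cliqueInserted, scalar_apply, ← smul_one_eq_diagonal, hy, add_smul, one_smul]
    abel
  have h2 : (1 : Matrix V V ℝ) - Rᵀ * ((c • (y • 1 + S)) * R) =
      c • ((scalar V) (y ^ 2 - 1 - r * y) - G.adjMatrix ℝ) := by
    rw [← Matrix.mul_assoc, Matrix.mul_smul, Matrix.smul_mul, Matrix.mul_add, Matrix.add_mul,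
      transpose_mul_dartSymmMatrix_mul, Matrix.mul_smul, Matrix.smul_mul, Matrix.mul_one,
      transpose_mul_dartFstMatrix G hG, scalar_apply, ← smul_one_eq_diagonal]
    simp only [smul_add, smul_sub, sub_smul, smul_smul]
    rw [show c * (y ^ 2) = 1 + c by rw [hc]; field_simp; ring]
    simp only [add_smul, one_smul, mul_one]
    rw [show c * (y * r) = c * (r * y) by ring]
    abel
  have heval : eval x (X ^ 2 + (2 - (r : ℝ[X])) * X - (r : ℝ[X])) = y ^ 2 - 1 - r * y := by
    simp [hy]; ring
  have hev2 : eval x (X ^ 2 + 2 * X : ℝ[X]) = y ^ 2 - 1 := by simp [hy]; ring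
  simp only [Set.mem_ofPred_eq, eval_mul, eval_pow (R := ℝ) (p := X ^ 2 + 2 * X), eval_comp, heval,
    hev2, eval_charpoly]
  rw [h1, det_mul, det_one_sub_mul_comm, h2, det_smul, det_smul_one_sub_dartSymmMatrix G hx2,
    hc, inv_pow]
  field_simp

theorem cliqueInserted_isRegularOfDegree {r : ℕ} (hG : G.IsRegularOfDegree r) :
    (cliqueInserted G).IsRegularOfDegree r := by
  intro d
  have hd := G.dart_fst_fiber_card_eq_degree d.fst
  rw [hG d.fst] at hd
  have h2 : d.symm.fst ≠ d.fst := fun h => d.fst_ne_snd h.symm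
  have h1 : (cliqueInserted G).neighborFinset d =
      insert d.symm ((Finset.univ.filter fun d' : G.Dart => d'.fst = d.fst).erase d) := by
    ext d'
    have h3 : (cliqueInserted G).Adj d d' ↔ d ≠ d' ∧ (d.fst = d'.fst ∨ d' = d.symm) := Iff.rfl
    simp only [mem_neighborFinset, h3, Finset.mem_insert, Finset.mem_erase, Finset.mem_filter,
      Finset.mem_univ, true_and]
    by_cases h : d' = d.symm
    · subst h; simp [d.symm_ne.symm]
    · simp [h, eq_comm]
  have hmem : d ∈ Finset.univ.filter fun d' : G.Dart => d'.fst = d.fst := by simp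
  rw [← card_neighborFinset_eq_degree, h1, Finset.card_insert_of_notMem (by simp),
    Finset.card_erase_of_mem hmem, hd]
  have : 0 < r := hd ▸ Finset.card_pos.2 ⟨d, hmem⟩
  omega

theorem IsRegularOfDegree.card_dart {V : Type*} [Fintype V] {G : SimpleGraph V}
    [DecidableRel G.Adj] {r : ℕ} (hG : G.IsRegularOfDegree r) : Fintype.card G.Dart = Fintype.card V * r := by
  simp [dart_card_eq_sum_degrees, hG.degree_eq]

end SimpleGraph

/-- The larger root of `x ^ 2 - x - 3 = a`. -/
noncomputable def cliqueRootPos (a : ℝ) : ℝ := (1 + √(13 + 4 * a)) / 2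

/-- The smaller root of `x ^ 2 - x - 3 = a`. -/
noncomputable def cliqueRootNeg (a : ℝ) : ℝ := (1 - √(13 + 4 * a)) / 2

/-- The spectrum of the clique-inserted graph of a cubic graph with `2 * k` vertices and
spectrum `s`. -/
noncomputable def cliqueSpectrum (k : ℕ) (s : Multiset ℝ) : Multiset ℝ :=
  Multiset.replicate k 0 + Multiset.replicate k (-2) +
    (s.map cliqueRootPos + s.map cliqueRootNeg)

theorem mem_Icc_of_mem_cliqueSpectrum {k : ℕ} {s : Multiset ℝ}
    (hs : ∀ a ∈ s, a ∈ Set.Icc (-3 : ℝ) 3) : ∀ a ∈ cliqueSpectrum k s, a ∈ Set.Icc (-3 : ℝ) 3 := by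
  have hsqrt : ∀ a ∈ s, 1 ≤ √(13 + 4 * a) ∧ √(13 + 4 * a) ≤ 5 := by
    intro a ha
    have h := hs a ha
    exact ⟨Real.le_sqrt_of_sq_le (by linarith [h.1]),
      (Real.sqrt_le_left (by norm_num)).2 (by linarith [h.2])⟩
  intro a ha
  simp only [cliqueSpectrum, Multiset.mem_add, Multiset.mem_map] at ha
  rcases ha with (ha | ha) | ⟨b, hb, rfl⟩ | ⟨b, hb, rfl⟩
  · rw [Multiset.eq_of_mem_replicate ha]; norm_num
  · rw [Multiset.eq_of_mem_replicate ha]; norm_num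
  · have := hsqrt b hb
    rw [cliqueRootPos]
    constructor <;> linarith
  · have := hsqrt b hb
    rw [cliqueRootNeg]
    constructor <;> linarith

open Polynomial in
theorem charpoly_cliqueInserted_eq_prod {V : Type*} [Fintype V] [DecidableEq V]
    (G : SimpleGraph V) [DecidableRel G.Adj] (hG : G.IsRegularOfDegree 3) {k : ℕ}
    (hk : Fintype.card V = 2 * k) {s : Multiset ℝ} (hs : ∀ a ∈ s, a ∈ Set.Icc (-3 : ℝ) 3)
    (h : (G.adjMatrix ℝ).charpoly = (s.map fun a => X - C a).prod) :
    ((cliqueInserted G).adjMatrix ℝ).charpoly =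
      ((cliqueSpectrum k s).map fun a => X - C a).prod := by
  have hE : Fintype.card G.edgeSet = k + 2 * k := by
    have h1 := hG.card_dart
    rw [SimpleGraph.dart_card_eq_twice_card_edges, SimpleGraph.edgeFinset_card] at h1
    omega
  have key := G.charpoly_cliqueInserted_mul hG
  have hne : (X ^ 2 + 2 * X : ℝ[X]) ≠ 0 := by
    intro h0
    have := congrArg (eval 1) h0
    norm_num at this
  rw [hk, hE, pow_add, mul_assoc, mul_comm ((X ^ 2 + 2 * X : ℝ[X]) ^ (2 * k)), ← mul_assoc] at key
  rw [mul_right_cancel₀ (pow_ne_zero _ hne) key, h, multiset_prod_comp, Multiset.map_map,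
    cliqueSpectrum]
  simp only [Multiset.map_add, Multiset.prod_add, Multiset.map_replicate, Multiset.prod_replicate,
    Multiset.map_map]
  rw [← mul_pow, ← Multiset.prod_map_mul]
  congr 2
  · rw [C_neg, C_0, C_ofNat]; ring
  · refine Multiset.map_congr rfl fun a ha => ?_
    have hsq : √(13 + 4 * a) ^ 2 = 13 + 4 * a := Real.sq_sqrt (by linarith [(hs a ha).1])
    have hadd : C (cliqueRootPos a) + C (cliqueRootNeg a) = (1 : ℝ[X]) := by
      rw [← C_add, ← C_1]; congr 1; rw [cliqueRootPos, cliqueRootNeg]; ring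
    have hmul : C (cliqueRootPos a) * C (cliqueRootNeg a) = (-3 - C a : ℝ[X]) := by
      rw [← C_mul, ← C_ofNat, ← C_neg, ← C_sub]
      congr 1
      rw [cliqueRootPos, cliqueRootNeg]
      linear_combination -hsq / 4
    simp only [Function.comp_apply, sub_comp, X_comp, C_comp]
    push_cast
    linear_combination X * hadd - hmul

/-- The squared absolute value of the symbol `1 + e^{ix} + e^{-iy}` of the hexagonal lattice. -/
noncomputable def hexSymbol (x y : ℝ) : ℝ :=
  3 + 2 * Real.cos x + 2 * Real.cos y + 2 * Real.cos (x + y)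

theorem hexSymbol_eq_normSq (x y : ℝ) :
    ((hexSymbol x y : ℝ) : ℂ) =
      (1 + Complex.exp (x * Complex.I) + Complex.exp (-(y * Complex.I))) *
        (1 + Complex.exp (-(x * Complex.I)) + Complex.exp (y * Complex.I)) := by
  have h1 : Complex.exp (x * Complex.I) * Complex.exp (-(x * Complex.I)) = 1 := by
    rw [← Complex.exp_add, add_neg_cancel, Complex.exp_zero]
  have h2 : Complex.exp (y * Complex.I) * Complex.exp (-(y * Complex.I)) = 1 := by
    rw [← Complex.exp_add, add_neg_cancel, Complex.exp_zero]
  rw [hexSymbol]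
  push_cast
  simp only [Complex.cos, neg_mul, add_mul, neg_add, Complex.exp_add]
  linear_combination (-1 : ℂ) * h1 - h2

theorem hexSymbol_nonneg (x y : ℝ) : 0 ≤ hexSymbol x y := by
  rw [hexSymbol, Real.cos_add]
  nlinarith [sq_nonneg (1 + Real.cos x + Real.cos y), sq_nonneg (Real.sin x - Real.sin y),
    Real.sin_sq_add_cos_sq x, Real.sin_sq_add_cos_sq y]

theorem hexSymbol_le (x y : ℝ) : hexSymbol x y ≤ 9 := by
  have h1 := Real.cos_le_one x
  have h2 := Real.cos_le_one y
  have h3 := Real.cos_le_one (x + y)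
  rw [hexSymbol]
  linarith

section HexagonalLattice

variable (n m : ℕ)

/-- The value of the symbol at a frequency of the discrete torus. -/
noncomputable def hexFreq (c : ZMod (n + 1) × ZMod (m + 1)) : ℝ :=
  hexSymbol (2 * Real.pi * c.1.val / (n + 1)) (2 * Real.pi * c.2.val / (m + 1))

/-- The spectrum of the toroidal hexagonal lattice. -/
noncomputable def hexSpectrum : Multiset ℝ :=
  (Finset.univ.val.map fun c => √(hexFreq n m c)) + Finset.univ.val.map fun c => -√(hexFreq n m c)

theorem mem_Icc_of_mem_hexSpectrum : ∀ a ∈ hexSpectrum n m, a ∈ Set.Icc (-3 : ℝ) 3 := by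
  have h : ∀ c, √(hexFreq n m c) ≤ 3 := fun c =>
    (Real.sqrt_le_left (by norm_num)).2 ((hexSymbol_le _ _).trans (by norm_num))
  intro a ha
  simp only [hexSpectrum, Multiset.mem_add, Multiset.mem_map] at ha
  rcases ha with ⟨c, -, rfl⟩ | ⟨c, -, rfl⟩ <;>
  constructor <;> linarith [h c, Real.sqrt_nonneg (hexFreq n m c)]

/-- The matrix of the relation `hexLink` between white and black vertices. -/
def hexBiadj (R : Type*) [Zero R] [One R] :
    Matrix (ZMod (n + 1) × ZMod (m + 1)) (ZMod (n + 1) × ZMod (m + 1)) R :=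
  Matrix.of fun p q => if hexLink p q then 1 else 0

/-- The matrix of the characters of the discrete torus. -/
noncomputable def torusCharMatrix :
    Matrix (ZMod (n + 1) × ZMod (m + 1)) (ZMod (n + 1) × ZMod (m + 1)) ℂ :=
  Matrix.of fun p c => ZMod.stdAddChar (p.1 * c.1) * ZMod.stdAddChar (-(p.2 * c.2))

open Matrix

theorem torusCharMatrix_det_ne_zero : (torusCharMatrix n m).det ≠ 0 := by
  let G : Matrix (ZMod (n + 1) × ZMod (m + 1)) (ZMod (n + 1) × ZMod (m + 1)) ℂ :=
    Matrix.of fun c p => ZMod.stdAddChar (-(p.1 * c.1)) * ZMod.stdAddChar (p.2 * c.2)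
  have h : torusCharMatrix n m * G = (((n + 1 : ℕ) : ℂ) * ((m + 1 : ℕ) : ℂ)) • 1 := by
    ext p p'
    simp only [torusCharMatrix, G, mul_apply, of_apply, Matrix.smul_apply, one_apply]
    have h1 : ∀ c : ZMod (n + 1) × ZMod (m + 1),
        (ZMod.stdAddChar (p.1 * c.1) * ZMod.stdAddChar (-(p.2 * c.2))) *
          (ZMod.stdAddChar (-(p'.1 * c.1)) * ZMod.stdAddChar (p'.2 * c.2)) =
        ZMod.stdAddChar (c.1 * (p.1 - p'.1)) * (ZMod.stdAddChar (c.2 * (p'.2 - p.2)) : ℂ) := by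
      intro c
      rw [show c.1 * (p.1 - p'.1) = p.1 * c.1 + -(p'.1 * c.1) by ring,
        show c.2 * (p'.2 - p.2) = -(p.2 * c.2) + p'.2 * c.2 by ring,
        AddChar.map_add_eq_mul, AddChar.map_add_eq_mul]
      ring
    simp only [h1]
    rw [Fintype.sum_prod_type]
    simp only
    rw [← Finset.sum_mul_sum, AddChar.sum_mulShift _ (ZMod.isPrimitive_stdAddChar _),
      AddChar.sum_mulShift _ (ZMod.isPrimitive_stdAddChar _), ZMod.card, ZMod.card]
    by_cases hp : p = p'
    · subst hp; simp
    · rw [if_neg hp]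
      by_cases h2 : p.1 = p'.1
      · have h3 : p'.2 - p.2 ≠ 0 := fun h => hp (Prod.ext h2 (sub_eq_zero.1 h).symm)
        simp [h3]
      · simp [sub_ne_zero.2 h2]
  intro h0
  have h2 := congrArg Matrix.det h
  rw [det_mul, h0, zero_mul, det_smul, det_one, mul_one] at h2
  exact pow_ne_zero _ (mul_ne_zero (Nat.cast_ne_zero.2 n.succ_ne_zero)
    (Nat.cast_ne_zero.2 m.succ_ne_zero)) h2.symm

theorem ofReal_hexFreq (c : ZMod (n + 1) × ZMod (m + 1)) :
    ((hexFreq n m c : ℝ) : ℂ) = (1 + ZMod.stdAddChar c.1 + ZMod.stdAddChar (-c.2)) *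
      (1 + ZMod.stdAddChar (-c.1) + ZMod.stdAddChar c.2) := by
  rw [hexFreq, hexSymbol_eq_normSq, AddChar.map_neg_eq_inv, AddChar.map_neg_eq_inv,
    ZMod.stdAddChar_apply, ZMod.stdAddChar_apply, ZMod.toCircle_apply, ZMod.toCircle_apply,
    ← Complex.exp_neg, ← Complex.exp_neg]
  have h1 : 2 * (Real.pi : ℂ) * Complex.I * c.1.val / ((n + 1 : ℕ) : ℂ) =
      ((2 * Real.pi * c.1.val / (n + 1) : ℝ) : ℂ) * Complex.I := by push_cast; ring
  have h2 : 2 * (Real.pi : ℂ) * Complex.I * c.2.val / ((m + 1 : ℕ) : ℂ) =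
      ((2 * Real.pi * c.2.val / (m + 1) : ℝ) : ℂ) * Complex.I := by push_cast; ring
  rw [h1, h2]

variable [Nontrivial (ZMod (n + 1))] [Nontrivial (ZMod (m + 1))]

theorem hexBiadj_apply (R : Type*) [NonAssocSemiring R] (p q : ZMod (n + 1) × ZMod (m + 1)) :
    hexBiadj n m R p q = (if q = p then 1 else 0) + (if q = (p.1 + 1, p.2) then 1 else 0) +
      (if q = (p.1, p.2 + 1) then 1 else 0) := by
  simp only [hexBiadj, of_apply, hexLink]
  by_cases h1 : q = p
  · subst h1; simp [Prod.ext_iff]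
  · by_cases h2 : q = (p.1 + 1, p.2)
    · simp [h2, Prod.ext_iff]
    · simp [h1, h2]

theorem hexBiadj_mul_torusCharMatrix :
    hexBiadj n m ℂ * torusCharMatrix n m = torusCharMatrix n m *
      diagonal fun c => 1 + ZMod.stdAddChar c.1 + (ZMod.stdAddChar (-c.2) : ℂ) := by
  ext p c
  rw [mul_diagonal, mul_apply]
  simp only [hexBiadj_apply, add_mul, ite_mul, one_mul, zero_mul, Finset.sum_add_distrib,
    Finset.sum_ite_eq', Finset.mem_univ, if_true]
  simp only [torusCharMatrix, of_apply, add_mul, one_mul, neg_add, AddChar.map_add_eq_mul]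
  ring

theorem hexBiadj_transpose_mul_torusCharMatrix :
    (hexBiadj n m ℂ)ᵀ * torusCharMatrix n m = torusCharMatrix n m *
      diagonal fun c => 1 + ZMod.stdAddChar (-c.1) + (ZMod.stdAddChar c.2 : ℂ) := by
  ext p c
  have h1 : ∀ q : ZMod (n + 1) × ZMod (m + 1), p = (q.1 + 1, q.2) ↔ q = (p.1 - 1, p.2) := by
    intro q; simp only [Prod.ext_iff, eq_sub_iff_add_eq]; tauto
  have h2 : ∀ q : ZMod (n + 1) × ZMod (m + 1), p = (q.1, q.2 + 1) ↔ q = (p.1, p.2 - 1) := by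
    intro q; simp only [Prod.ext_iff, eq_sub_iff_add_eq]; tauto
  rw [mul_diagonal, mul_apply]
  simp only [transpose_apply, hexBiadj_apply, add_mul, ite_mul, one_mul, zero_mul,
    Finset.sum_add_distrib, h1, h2, Finset.sum_ite_eq', Finset.sum_ite_eq, Finset.mem_univ, if_true]
  have h3 : ∀ p : ZMod (n + 1) × ZMod (m + 1), torusCharMatrix n m p c =
      ZMod.stdAddChar (p.1 * c.1) * ZMod.stdAddChar (-(p.2 * c.2)) := fun _ => rfl
  rw [h3, h3, h3, show (p.1 - 1) * c.1 = p.1 * c.1 + -c.1 by ring,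
    show -((p.2 - 1) * c.2) = -(p.2 * c.2) + c.2 by ring, AddChar.map_add_eq_mul,
    AddChar.map_add_eq_mul]
  ring

theorem det_sub_hexBiadj (z : ℝ) :
    (diagonal (fun _ => z) - (hexBiadj n m ℝ)ᵀ * hexBiadj n m ℝ).det =
      ∏ c, (z - hexFreq n m c) := by
  have hmap : (hexBiadj n m ℝ).map Complex.ofRealHom = hexBiadj n m ℂ := by
    ext p q
    simp only [hexBiadj, map_apply, of_apply]
    split_ifs <;> simp
  set F := torusCharMatrix n m with hF
  have key : (diagonal (fun _ => (z : ℂ)) - (hexBiadj n m ℂ)ᵀ * hexBiadj n m ℂ) * F =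
      F * diagonal fun c => (z : ℂ) - hexFreq n m c := by
    rw [Matrix.sub_mul, Matrix.mul_assoc, hexBiadj_mul_torusCharMatrix, ← Matrix.mul_assoc,
      hexBiadj_transpose_mul_torusCharMatrix, Matrix.mul_assoc, diagonal_mul_diagonal]
    ext p c
    rw [Matrix.sub_apply, diagonal_mul, mul_diagonal, mul_diagonal, ofReal_hexFreq, hF]
    ring
  have h2 := congrArg Matrix.det key
  rw [det_mul, det_mul, det_diagonal, mul_comm] at h2
  have h3 := mul_left_cancel₀ (torusCharMatrix_det_ne_zero n m) h2
  apply Complex.ofReal_injective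
  have h4 := RingHom.map_det Complex.ofRealHom
    (diagonal (fun _ => z) - (hexBiadj n m ℝ)ᵀ * hexBiadj n m ℝ)
  rw [Complex.ofRealHom_eq_coe] at h4
  rw [h4]
  push_cast
  rw [← h3]
  congr 1
  rw [RingHom.mapMatrix_apply, Matrix.map_sub _ (map_sub _), Matrix.map_mul, transpose_map, hmap,
    diagonal_map (map_zero _)]
  rfl

open Polynomial in
theorem charpoly_hexToroidal :
    ((hexToroidal n m).adjMatrix ℝ).charpoly =
      ((hexSpectrum n m).map fun a => X - C a).prod := by
  refine eq_of_infinite_eval_eq _ _ (((Set.toFinite {0}).infinite_compl).mono ?_)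
  intro x hx
  have hx0 : x ≠ 0 := hx
  have hR : eval x ((hexSpectrum n m).map fun a => X - C a).prod =
      ∏ c, (x ^ 2 - hexFreq n m c) := by
    rw [hexSpectrum, Multiset.map_add, Multiset.prod_add, eval_mul, Multiset.map_map,
      Multiset.map_map]
    change eval x (∏ c, _) * eval x (∏ c, _) = _
    rw [eval_prod, eval_prod, ← Finset.prod_mul_distrib]
    refine Finset.prod_congr rfl fun c _ => ?_
    have := Real.sq_sqrt (hexSymbol_nonneg (2 * Real.pi * c.1.val / (n + 1))
      (2 * Real.pi * c.2.val / (m + 1)))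
    simp only [Function.comp_apply, eval_sub, eval_X, eval_C]
    rw [hexFreq]
    linear_combination -this
  rw [Set.mem_ofPred_eq, hR, ← det_sub_hexBiadj, eval_charpoly]
  let e := Equiv.boolProdEquivSum (ZMod (n + 1) × ZMod (m + 1))
  set B := hexBiadj n m ℝ with hB
  have hblock : ((scalar (HexVertex n m)) x - (hexToroidal n m).adjMatrix ℝ).submatrix e.symm e.symm
      = fromBlocks (diagonal fun _ => x) (-B) (-Bᵀ) (diagonal fun _ => x) := by
    ext (p | p) (q | q)
    · have : ¬ (hexToroidal n m).Adj (false, p) (false, q) := by simp [hexToroidal]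
      simp [e, Equiv.boolProdEquivSum, diagonal_apply, this]
    · have : (hexToroidal n m).Adj (false, p) (true, q) ↔ hexLink p q := by simp [hexToroidal]
      simp [e, Equiv.boolProdEquivSum, this, hB, hexBiadj]
    · have : (hexToroidal n m).Adj (true, p) (false, q) ↔ hexLink q p := by simp [hexToroidal]
      simp [e, Equiv.boolProdEquivSum, this, hB, hexBiadj]
    · have : ¬ (hexToroidal n m).Adj (true, p) (true, q) := by simp [hexToroidal]
      simp [e, Equiv.boolProdEquivSum, diagonal_apply, this]
  rw [← det_submatrix_equiv_self e.symm, hblock]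
  have hsc : (diagonal fun _ => x : Matrix (ZMod (n + 1) × ZMod (m + 1)) _ ℝ) = x • 1 :=
    (smul_one_eq_diagonal x).symm
  let _ : Invertible (x • (1 : Matrix (ZMod (n + 1) × ZMod (m + 1)) (ZMod (n + 1) × ZMod (m + 1)) ℝ)) :=
    ⟨x⁻¹ • 1, by simp [smul_smul, hx0], by simp [smul_smul, hx0]⟩
  have hinv : ⅟(x • (1 : Matrix (ZMod (n + 1) × ZMod (m + 1)) (ZMod (n + 1) × ZMod (m + 1)) ℝ)) =
    x⁻¹ • 1 := rfl
  rw [hsc, det_fromBlocks₁₁, hinv, ← det_mul]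
  congr 1
  rw [Matrix.smul_mul, Matrix.one_mul, Matrix.mul_smul, Matrix.mul_one, Matrix.smul_mul,
    Matrix.neg_mul, Matrix.mul_neg, neg_neg, smul_sub, smul_smul, smul_smul, mul_inv_cancel₀ hx0,
    one_smul, ← sq, smul_one_eq_diagonal]

theorem hexToroidal_isRegularOfDegree : (hexToroidal n m).IsRegularOfDegree 3 := by
  rintro ⟨b, p⟩
  rw [← SimpleGraph.card_neighborFinset_eq_degree]
  cases b
  · have h : (hexToroidal n m).neighborFinset (false, p) =
        {(true, p), (true, p.1 + 1, p.2), (true, p.1, p.2 + 1)} := by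
      ext ⟨b, q⟩
      rw [SimpleGraph.mem_neighborFinset]
      cases b <;> simp [hexToroidal, hexLink]
    rw [h, Finset.card_eq_three]
    exact ⟨_, _, _, by simp [Prod.ext_iff], by simp [Prod.ext_iff], by simp, rfl⟩
  · have h : (hexToroidal n m).neighborFinset (true, p) =
        {(false, p), (false, p.1 - 1, p.2), (false, p.1, p.2 - 1)} := by
      ext ⟨b, q⟩
      rw [SimpleGraph.mem_neighborFinset]
      cases b
      · have h1 : hexLink q p ↔ q = p ∨ q = (p.1 - 1, p.2) ∨ q = (p.1, p.2 - 1) := by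
          simp only [hexLink, Prod.ext_iff, eq_sub_iff_add_eq]
          tauto
        simpa [hexToroidal] using h1
      · simp [hexToroidal, hexLink]
    rw [h, Finset.card_eq_three]
    have h1 : ∀ {R : Type} [Ring R] [Nontrivial R] (a : R), a ≠ a - 1 := fun a h => by
      simp [eq_sub_iff_add_eq] at h
    exact ⟨_, _, _, by simp [Prod.ext_iff, h1], by simp [Prod.ext_iff, h1], by simp, rfl⟩

end HexagonalLattice

/-- The contribution of a frequency to the energy of the 3-6-24 lattice. -/
noncomputable def hexDensity (x y : ℝ) : ℝ :=
  √(15 + 2 * √(13 + 4 * √(3 + 2 * Real.cos x + 2 * Real.cos y + 2 * Real.cos (x + y))))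
    + √(15 + 2 * √(13 - 4 * √(3 + 2 * Real.cos x + 2 * Real.cos y + 2 * Real.cos (x + y))))
    + √(15 - 2 * √(13 + 4 * √(3 + 2 * Real.cos x + 2 * Real.cos y + 2 * Real.cos (x + y))))
    + √(15 - 2 * √(13 - 4 * √(3 + 2 * Real.cos x + 2 * Real.cos y + 2 * Real.cos (x + y))))

theorem continuous_hexDensity : Continuous fun p : ℝ × ℝ => hexDensity p.1 p.2 := by
  unfold hexDensity
  fun_prop

theorem sum_abs_cliqueSpectrum {k : ℕ} {s : Multiset ℝ} (hs : ∀ a ∈ s, a ∈ Set.Icc (-3 : ℝ) 3) :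
    ((cliqueSpectrum k s).map fun a => |a|).sum = 2 * k + (s.map fun a => √(13 + 4 * a)).sum := by
  simp only [cliqueSpectrum, Multiset.map_add, Multiset.sum_add, Multiset.map_replicate,
    Multiset.sum_replicate, Multiset.map_map]
  rw [← Multiset.sum_map_add]
  congr 1
  · rw [abs_zero, abs_neg, abs_two]; simp [mul_comm]
  · refine congrArg Multiset.sum (Multiset.map_congr rfl fun a ha => ?_)
    have h : 1 ≤ √(13 + 4 * a) := Real.le_sqrt_of_sq_le (by linarith [(hs a ha).1])
    simp only [Function.comp_apply, cliqueRootPos, cliqueRootNeg]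
    rw [abs_of_nonneg (by linarith), abs_of_nonpos (by linarith)]
    ring

theorem sum_sqrt_cliqueSpectrum (k : ℕ) (s : Multiset ℝ) :
    ((cliqueSpectrum k s).map fun a => √(13 + 4 * a)).sum = k * (√5 + √13) +
      (s.map fun a => √(15 + 2 * √(13 + 4 * a)) + √(15 - 2 * √(13 + 4 * a))).sum := by
  simp only [cliqueSpectrum, Multiset.map_add, Multiset.sum_add, Multiset.map_replicate,
    Multiset.sum_replicate, Multiset.map_map]
  rw [← Multiset.sum_map_add]
  congr 1
  · norm_num; ring
  · refine congrArg Multiset.sum (Multiset.map_congr rfl fun a _ => ?_)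
    simp only [Function.comp_apply, cliqueRootPos, cliqueRootNeg]
    congr 2 <;> ring

theorem card_hexVertex (n m : ℕ) : Fintype.card (HexVertex n m) = 2 * ((n + 1) * (m + 1)) := by
  simp [ZMod.card]

theorem ZMod.sum_val {M : Type*} [AddCommMonoid M] (f : ℕ → M) (n : ℕ) :
    ∑ k : ZMod (n + 1), f k.val = ∑ k ∈ Finset.range (n + 1), f k :=
  Fin.sum_univ_eq_sum_range f (n + 1)

/-- The energy of the toroidal 3-6-24 lattice. -/
theorem graphEnergy_lattice3624Toroidal (n m : ℕ) (hn : 1 ≤ n) (hm : 1 ≤ m) :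
    graphEnergy (lattice3624Toroidal n m) =
      (n + 1) * (m + 1) * (√5 + √13 + 6) + ∑ k ∈ Finset.range (n + 1), ∑ l ∈ Finset.range (m + 1),
        hexDensity (2 * Real.pi * k / (n + 1)) (2 * Real.pi * l / (m + 1)) := by
  have : Fact (1 < n + 1) := ⟨by lia⟩
  have : Fact (1 < m + 1) := ⟨by lia⟩
  have h1 := hexToroidal_isRegularOfDegree n m
  have h2 := (hexToroidal n m).cliqueInserted_isRegularOfDegree h1
  have hs1 := mem_Icc_of_mem_hexSpectrum n m
  have hs2 := mem_Icc_of_mem_cliqueSpectrum (k := (n + 1) * (m + 1)) hs1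
  have hcard : Fintype.card (hexToroidal n m).Dart = 2 * (3 * ((n + 1) * (m + 1))) := by
    rw [h1.card_dart, card_hexVertex]; ring
  have hp1 := charpoly_cliqueInserted_eq_prod _ h1 (card_hexVertex n m) hs1
    (charpoly_hexToroidal n m)
  have hp2 := charpoly_cliqueInserted_eq_prod _ h2 hcard hs2 hp1
  rw [graphEnergy_eq_of_charpoly _ _ hp2, sum_abs_cliqueSpectrum hs2, sum_sqrt_cliqueSpectrum,
    hexSpectrum, Multiset.map_add, Multiset.sum_add, Multiset.map_map, Multiset.map_map,
    ← Multiset.sum_map_add]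
  have h3 : ∑ c : ZMod (n + 1) × ZMod (m + 1),
      hexDensity (2 * Real.pi * c.1.val / (n + 1)) (2 * Real.pi * c.2.val / (m + 1)) =
      ∑ k ∈ Finset.range (n + 1), ∑ l ∈ Finset.range (m + 1),
        hexDensity (2 * Real.pi * k / (n + 1)) (2 * Real.pi * l / (m + 1)) := by
    simp only [Fintype.sum_prod_type, ← ZMod.sum_val]
  rw [← h3, Finset.sum]
  have h4 : ∀ c : ZMod (n + 1) × ZMod (m + 1),
      hexDensity (2 * Real.pi * c.1.val / (n + 1)) (2 * Real.pi * c.2.val / (m + 1)) =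
      (√(15 + 2 * √(13 + 4 * √(hexFreq n m c))) + √(15 - 2 * √(13 + 4 * √(hexFreq n m c)))) +
      (√(15 + 2 * √(13 + 4 * -√(hexFreq n m c))) + √(15 - 2 * √(13 + 4 * -√(hexFreq n m c)))) := by
    intro c
    simp only [hexDensity, hexFreq, hexSymbol, mul_neg, ← sub_eq_add_neg]
    ring
  simp only [h4, Function.comp_apply]
  push_cast
  ring

section RiemannSum

theorem abs_riemannSum_sub_integral_le {f : ℝ → ℝ} (hf : Continuous f) {a ε : ℝ} (ha : 0 ≤ a)
    {N : ℕ} (hN : 0 < N)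
    (h : ∀ x ∈ Set.Icc 0 a, ∀ y ∈ Set.Icc 0 a, |x - y| ≤ a / N → |f x - f y| ≤ ε) :
    |a / N * ∑ k ∈ Finset.range N, f (a * k / N) - ∫ x in (0 : ℝ)..a, f x| ≤ a * ε := by
  have hN' : (0 : ℝ) < N := Nat.cast_pos.2 hN
  have h1 : ∫ x in (0 : ℝ)..a, f x =
      ∑ k ∈ Finset.range N, ∫ x in (a * k / N)..(a * (k + 1 : ℕ) / N), f x := by
    rw [intervalIntegral.sum_integral_adjacent_intervals (a := fun k : ℕ => a * k / N)
      fun k _ => hf.intervalIntegrable _ _]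
    simp [hN'.ne']
  rw [h1, Finset.mul_sum, ← Finset.sum_sub_distrib]
  have h2 : ∀ k ∈ Finset.range N,
      |a / N * f (a * k / N) - ∫ x in (a * k / N)..(a * (k + 1 : ℕ) / N), f x| ≤ ε * (a / N) := by
    intro k hk
    have hk' : ((k + 1 : ℕ) : ℝ) ≤ N := by exact_mod_cast Finset.mem_range.1 hk
    have hstep : a * (k + 1 : ℕ) / N - a * k / N = a / N := by push_cast; ring
    have hle : a * k / N ≤ a * (k + 1 : ℕ) / N := by
      have : 0 ≤ a / N := by positivity
      linarith
    have htop : a * (k + 1 : ℕ) / N ≤ a := by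
      rw [div_le_iff₀ hN']
      exact mul_le_mul_of_nonneg_left hk' ha
    have hbot : 0 ≤ a * k / N := by positivity
    have h3 : a / N * f (a * k / N) = ∫ x in (a * k / N)..(a * (k + 1 : ℕ) / N), f (a * k / N) := by
      rw [intervalIntegral.integral_const, hstep, smul_eq_mul]
    rw [h3, ← intervalIntegral.integral_sub (by simp) (hf.intervalIntegrable _ _)]
    have h4 := intervalIntegral.norm_integral_le_of_norm_le_const (C := ε)
      (f := fun x => f (a * k / N) - f x) (a := a * k / N) (b := a * (k + 1 : ℕ) / N) ?_
    · rwa [hstep, abs_of_nonneg (by positivity)] at h4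
    · intro x hx
      rw [Set.uIoc_of_le hle] at hx
      refine h _ ⟨hbot, hle.trans htop⟩ _ ⟨hbot.trans hx.1.le, hx.2.trans htop⟩ ?_
      rw [abs_sub_comm, abs_of_nonneg (by linarith [hx.1])]
      linarith [hx.2]
  refine (Finset.abs_sum_le_sum_abs _ _).trans ((Finset.sum_le_sum h2).trans_eq ?_)
  rw [Finset.sum_const, Finset.card_range, nsmul_eq_mul]
  field_simp

/-- The Riemann sums of a continuous function of two variables converge to its integral, as both
meshes tend to `0` independently of each other. -/
theorem tendsto_riemannSum_integral {f : ℝ → ℝ → ℝ} (hf : Continuous fun p : ℝ × ℝ => f p.1 p.2)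
    {a : ℝ} (ha : 0 < a) :
    Tendsto (fun p : ℕ × ℕ => a / (p.1 + 1) * (a / (p.2 + 1)) *
        ∑ k ∈ Finset.range (p.1 + 1), ∑ l ∈ Finset.range (p.2 + 1),
          f (a * k / (p.1 + 1)) (a * l / (p.2 + 1)))
      atTop (𝓝 (∫ x in (0 : ℝ)..a, ∫ y in (0 : ℝ)..a, f x y)) := by
  have hI : Continuous fun x => ∫ y in (0 : ℝ)..a, f x y :=
    intervalIntegral.continuous_parametric_intervalIntegral_of_continuous' hf 0 a
  rw [Metric.tendsto_nhds]
  intro η hη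
  obtain ⟨ε, hε, hεη⟩ : ∃ ε > 0, a * (a * ε) + a * (a * ε) < η := by
    refine ⟨η / (4 * a ^ 2), by positivity, ?_⟩
    field_simp
    linarith
  have hK : IsCompact (Set.Icc 0 a ×ˢ Set.Icc 0 a) := isCompact_Icc.prod isCompact_Icc
  obtain ⟨δ, hδ, hfδ⟩ := Metric.uniformContinuousOn_iff.1
    (hK.uniformContinuousOn_of_continuous hf.continuousOn) ε hε
  have hmesh : ∀ᶠ n : ℕ in atTop, a / (n + 1) < δ := by
    have h := tendsto_one_div_add_atTop_nhds_zero_nat (𝕜 := ℝ) |>.const_mul a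
    rw [mul_zero] at h
    filter_upwards [h.eventually_lt_const hδ] with n hn
    rwa [mul_one_div] at hn
  rw [← prod_atTop_atTop_eq]
  filter_upwards [hmesh.prod_mk hmesh] with ⟨n, m⟩ ⟨hn, hm⟩
  simp only at hn hm ⊢
  have hx : ∀ x ∈ Set.Icc 0 a, ∀ x' ∈ Set.Icc 0 a, |x - x'| ≤ a / ((n + 1 : ℕ) : ℝ) →
      ∀ y ∈ Set.Icc 0 a, |f x y - f x' y| ≤ ε := by
    intro x hx x' hx' hxx y hy
    push_cast at hxx
    refine (hfδ (x, y) ⟨hx, hy⟩ (x', y) ⟨hx', hy⟩ ?_).le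
    rw [Prod.dist_eq, dist_self, max_eq_left dist_nonneg, Real.dist_eq]
    exact hxx.trans_lt hn
  have hy : ∀ x ∈ Set.Icc 0 a, ∀ y ∈ Set.Icc 0 a, ∀ y' ∈ Set.Icc 0 a,
      |y - y'| ≤ a / ((m + 1 : ℕ) : ℝ) → |f x y - f x y'| ≤ ε := by
    intro x hx y hy y' hy' hyy
    push_cast at hyy
    refine (hfδ (x, y) ⟨hx, hy⟩ (x, y') ⟨hx, hy'⟩ ?_).le
    rw [Prod.dist_eq, dist_self, max_eq_right dist_nonneg, Real.dist_eq]
    exact hyy.trans_lt hm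
  have hfx : ∀ x, Continuous (f x) := fun x => hf.comp (Continuous.prodMk_right x)
  have h1 := abs_riemannSum_sub_integral_le (ε := a * ε) hI ha.le n.succ_pos (by
    intro x hx0 x' hx0' hxx
    rw [← intervalIntegral.integral_sub ((hfx x).intervalIntegrable _ _)
      ((hfx x').intervalIntegrable _ _)]
    have h4 := intervalIntegral.norm_integral_le_of_norm_le_const (C := ε)
      (f := fun y => f x y - f x' y) (a := 0) (b := a) ?_
    · rw [sub_zero, abs_of_pos ha, mul_comm] at h4; exact h4
    · intro y hy
      rw [Set.uIoc_of_le ha.le] at hy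
      exact hx x hx0 x' hx0' hxx y ⟨hy.1.le, hy.2⟩)
  have h2 : |a / ((n + 1 : ℕ) : ℝ) * ∑ k ∈ Finset.range (n + 1),
      (a / ((m + 1 : ℕ) : ℝ) * ∑ l ∈ Finset.range (m + 1),
        f (a * k / ((n + 1 : ℕ) : ℝ)) (a * l / ((m + 1 : ℕ) : ℝ)) -
          ∫ y in (0 : ℝ)..a, f (a * k / ((n + 1 : ℕ) : ℝ)) y)| ≤ a * (a * ε) := by
    have hpos : (0 : ℝ) < ((n + 1 : ℕ) : ℝ) := Nat.cast_pos.2 n.succ_pos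
    rw [abs_mul, abs_of_nonneg (by positivity)]
    have h3 : ∀ k ∈ Finset.range (n + 1), |a / ((m + 1 : ℕ) : ℝ) * ∑ l ∈ Finset.range (m + 1),
        f (a * k / ((n + 1 : ℕ) : ℝ)) (a * l / ((m + 1 : ℕ) : ℝ)) -
          ∫ y in (0 : ℝ)..a, f (a * k / ((n + 1 : ℕ) : ℝ)) y| ≤ a * ε := by
      intro k hk
      have hk' : (k : ℝ) ≤ ((n + 1 : ℕ) : ℝ) := by exact_mod_cast (Finset.mem_range.1 hk).le
      refine abs_riemannSum_sub_integral_le (hfx _) ha.le m.succ_pos (hy _ ⟨by positivity, ?_⟩)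
      rw [div_le_iff₀ hpos]
      exact mul_le_mul_of_nonneg_left hk' ha.le
    calc a / ((n + 1 : ℕ) : ℝ) * |_| ≤ a / ((n + 1 : ℕ) : ℝ) *
          ∑ k ∈ Finset.range (n + 1), a * ε := by
          gcongr
          exact (Finset.abs_sum_le_sum_abs _ _).trans (Finset.sum_le_sum h3)
      _ = a * (a * ε) := by
          rw [Finset.sum_const, Finset.card_range, nsmul_eq_mul]
          field_simp
  rw [Real.dist_eq]
  refine lt_of_le_of_lt ?_ hεη
  refine le_trans (le_of_eq ?_) ((abs_add_le _ _).trans (add_le_add h2 h1))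
  congr 1
  rw [Finset.sum_sub_distrib, ← Finset.mul_sum]
  push_cast
  ring

end RiemannSum

theorem ncard_pair_mem_keptEdges_le {V : Type*} [Finite V] (G : SimpleGraph V) (s : Set (Sym2 V)) :
    Set.ncard {p : G.Dart × G.Dart | s(p.1, p.2) ∈ keptEdges G s} ≤
      Set.ncard {p : V × V | s(p.1, p.2) ∈ s} := by
  have key : ∀ p : G.Dart × G.Dart, s(p.1, p.2) ∈ keptEdges G s →
      p.2 = p.1.symm ∧ p.1.edge ∈ s := by
    rintro ⟨d, d'⟩ ⟨x, hx, h⟩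
    obtain ⟨h1, h2⟩ | ⟨h1, h2⟩ := Sym2.eq_iff.1 h <;> simp only at h1 h2 <;> subst h1 h2
    · exact ⟨rfl, hx⟩
    · exact ⟨(SimpleGraph.Dart.symm_symm _).symm, by rwa [SimpleGraph.Dart.edge_symm]⟩
  refine Set.ncard_le_ncard_of_injOn (fun p => p.1.toProd) (fun p hp => ?_) (fun p hp q hq h => ?_)
    (Set.toFinite _)
  · exact (key p hp).2
  · have h1 : p.1 = q.1 := SimpleGraph.Dart.toProd_injective h
    exact Prod.ext h1 (by rw [(key p hp).1, (key q hq).1, h1])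

theorem ncard_pair_mem_hexSeamA_le (n m : ℕ) :
    Set.ncard {p : HexVertex n m × HexVertex n m | s(p.1, p.2) ∈ hexSeamA n m} ≤ 2 * (m + 1) := by
  have hcard : (Set.univ : Set (Bool × ZMod (m + 1))).ncard = 2 * (m + 1) := by
    simp [Set.ncard_univ, ZMod.card]
  rw [← hcard]
  refine Set.ncard_le_ncard_of_injOn (fun p => (p.1.1, p.1.2.2)) (fun _ _ => Set.mem_univ _) ?_
    (Set.toFinite _)
  rintro ⟨p, p'⟩ ⟨i, hp⟩ ⟨q, q'⟩ ⟨j, hq⟩ h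
  rcases Sym2.eq_iff.1 hp with ⟨rfl, rfl⟩ | ⟨rfl, rfl⟩ <;>
  rcases Sym2.eq_iff.1 hq with ⟨rfl, rfl⟩ | ⟨rfl, rfl⟩ <;> simp_all

theorem ncard_pair_mem_hexSeamB_le (n m : ℕ) :
    Set.ncard {p : HexVertex n m × HexVertex n m | s(p.1, p.2) ∈ hexSeamB n m} ≤ 2 * (n + 1) := by
  have hcard : (Set.univ : Set (Bool × ZMod (n + 1))).ncard = 2 * (n + 1) := by
    simp [Set.ncard_univ, ZMod.card]
  rw [← hcard]
  refine Set.ncard_le_ncard_of_injOn (fun p => (p.1.1, p.1.2.1)) (fun _ _ => Set.mem_univ _) ?_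
    (Set.toFinite _)
  rintro ⟨p, p'⟩ ⟨i, hp⟩ ⟨q, q'⟩ ⟨j, hq⟩ h
  rcases Sym2.eq_iff.1 hp with ⟨rfl, rfl⟩ | ⟨rfl, rfl⟩ <;>
  rcases Sym2.eq_iff.1 hq with ⟨rfl, rfl⟩ | ⟨rfl, rfl⟩ <;> simp_all

theorem abs_graphEnergy_cylindrical_sub_le (n m : ℕ) :
    |graphEnergy (lattice3624Cylindrical n m) - graphEnergy (lattice3624Toroidal n m)| ≤
      2 * (n + 1) := by
  refine (abs_graphEnergy_deleteEdges_sub_le _ _).trans ?_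
  exact_mod_cast (ncard_pair_mem_keptEdges_le _ _).trans
    ((ncard_pair_mem_keptEdges_le _ _).trans (ncard_pair_mem_hexSeamB_le n m))

theorem abs_graphEnergy_free_sub_le (n m : ℕ) :
    |graphEnergy (lattice3624Free n m) - graphEnergy (lattice3624Cylindrical n m)| ≤
      2 * (m + 1) := by
  refine (abs_graphEnergy_deleteEdges_sub_le _ _).trans ?_
  exact_mod_cast (ncard_pair_mem_keptEdges_le _ _).trans
    ((ncard_pair_mem_keptEdges_le _ _).trans (ncard_pair_mem_hexSeamA_le n m))

theorem tendsto_graphEnergy_lattice3624Toroidal :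
    Tendsto (fun p : ℕ × ℕ =>
        graphEnergy (lattice3624Toroidal p.1 p.2) / (18 * (p.1 : ℝ) * (p.2 : ℝ))) atTop
      (𝓝 (1 / (72 * Real.pi ^ 2) * (∫ x in (0 : ℝ)..(2 * Real.pi), ∫ y in (0 : ℝ)..(2 * Real.pi),
        hexDensity x y) + (√5 + √13 + 6) / 18)) := by
  have h1 := tendsto_riemannSum_integral continuous_hexDensity Real.two_pi_pos
  have hr : Tendsto (fun n : ℕ => ((n : ℝ) + 1) / n) atTop (𝓝 1) := by
    have h : Tendsto (fun n : ℕ => 1 + (1 : ℝ) / n) atTop (𝓝 (1 + 0)) :=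
      tendsto_const_nhds.add tendsto_one_div_atTop_nhds_zero_nat
    rw [add_zero] at h
    refine h.congr' ?_
    filter_upwards [eventually_ge_atTop 1] with n hn
    have : (n : ℝ) ≠ 0 := by positivity
    field_simp
  have hr2 : Tendsto (fun p : ℕ × ℕ => (((p.1 : ℝ) + 1) / p.1) * (((p.2 : ℝ) + 1) / p.2)) atTop
      (𝓝 (1 * 1)) := by
    rw [← prod_atTop_atTop_eq]
    exact (hr.comp tendsto_fst).mul (hr.comp tendsto_snd)
  have h2 := hr2.mul ((h1.const_mul (1 / (72 * Real.pi ^ 2))).add_const ((√5 + √13 + 6) / 18))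
  rw [one_mul, one_mul] at h2
  refine h2.congr' ?_
  filter_upwards [eventually_ge_atTop (1, 1)] with ⟨n, m⟩ hnm
  obtain ⟨hn, hm⟩ : 1 ≤ n ∧ 1 ≤ m := hnm
  rw [graphEnergy_lattice3624Toroidal n m hn hm]
  have hn0 : (n : ℝ) ≠ 0 := by positivity
  have hm0 : (m : ℝ) ≠ 0 := by positivity
  have hn1 : (n : ℝ) + 1 ≠ 0 := by positivity
  have hm1 : (m : ℝ) + 1 ≠ 0 := by positivity
  have hpi := Real.pi_ne_zero
  simp only
  generalize ∑ k ∈ Finset.range (n + 1), ∑ l ∈ Finset.range (m + 1),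
    hexDensity (2 * Real.pi * k / (n + 1)) (2 * Real.pi * l / (m + 1)) = S
  field_simp
  ring

/-- Two functions on `ℕ × ℕ` that differ by at most `2 * (n + 1) + 2 * (m + 1)` have the same limit
after division by `18 * n * m`. -/
theorem tendsto_div_of_abs_sub_le {f g : ℕ × ℕ → ℝ} {L : ℝ}
    (hfg : ∀ p, |g p - f p| ≤ 2 * (p.1 + 1) + 2 * (p.2 + 1))
    (hf : Tendsto (fun p => f p / (18 * (p.1 : ℝ) * (p.2 : ℝ))) atTop (𝓝 L)) :
    Tendsto (fun p => g p / (18 * (p.1 : ℝ) * (p.2 : ℝ))) atTop (𝓝 L) := by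
  have h0 : Tendsto (fun p : ℕ × ℕ => (1 : ℝ) / p.1 + 1 / p.2) atTop (𝓝 (0 + 0)) := by
    rw [← prod_atTop_atTop_eq]
    exact (tendsto_one_div_atTop_nhds_zero_nat.comp tendsto_fst).add
      (tendsto_one_div_atTop_nhds_zero_nat.comp tendsto_snd)
  rw [add_zero] at h0
  have h1 : Tendsto (fun p => g p / (18 * (p.1 : ℝ) * (p.2 : ℝ)) -
      f p / (18 * (p.1 : ℝ) * (p.2 : ℝ))) atTop (𝓝 0) := by
    refine squeeze_zero_norm' ?_ h0
    filter_upwards [eventually_ge_atTop (1, 1)] with ⟨n, m⟩ hnm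
    obtain ⟨hn, hm⟩ : 1 ≤ n ∧ 1 ≤ m := hnm
    have hn1 : (1 : ℝ) ≤ n := by exact_mod_cast hn
    have hm1 : (1 : ℝ) ≤ m := by exact_mod_cast hm
    have h := hfg (n, m)
    simp only at h ⊢
    rw [← sub_div, Real.norm_eq_abs, abs_div, abs_of_pos (by positivity : (0 : ℝ) < 18 * n * m),
      div_le_iff₀ (by positivity)]
    have h2 : ((1 : ℝ) / n + 1 / m) * (18 * n * m) = 18 * n + 18 * m := by
      field_simp
      ring
    linarith
  simpa using h1.add hf

section Bounds

theorem Real.sqrt_le_tangent {z c : ℝ} (hz : 0 ≤ z) (hc : 0 < c) : √z ≤ (z + c ^ 2) / (2 * c) := by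
  rw [le_div_iff₀ (by positivity)]
  nlinarith [sq_nonneg (√z - c), Real.sq_sqrt hz]

theorem sq_sqrt_add_sqrt {a b : ℝ} (ha : 0 ≤ a) (hb : 0 ≤ b) :
    (√a + √b) ^ 2 = a + b + 2 * √(a * b) := by
  rw [Real.sqrt_mul ha, add_sq, Real.sq_sqrt ha, Real.sq_sqrt hb]
  ring

theorem sqrt_add_sqrt_sub_eq {a : ℝ} (ha : a ∈ Set.Icc (-3 : ℝ) 3) :
    √(15 + 2 * √(13 + 4 * a)) + √(15 - 2 * √(13 + 4 * a)) = √(30 + 2 * √(173 - 16 * a)) := by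
  have hs : √(13 + 4 * a) ^ 2 = 13 + 4 * a := Real.sq_sqrt (by linarith [ha.1])
  have h5 : √(13 + 4 * a) ≤ 5 := (Real.sqrt_le_left (by norm_num)).2 (by linarith [ha.2])
  symm
  rw [Real.sqrt_eq_iff_eq_sq (by positivity) (by positivity),
    sq_sqrt_add_sqrt (by positivity) (by linarith)]
  rw [show (15 + 2 * √(13 + 4 * a)) * (15 - 2 * √(13 + 4 * a)) = 173 - 16 * a by
    linear_combination -4 * hs]
  ring

/-- The density in terms of nested square roots that are concave in the squared symbol `t`. -/
theorem sqrt_add_sqrt_neg_eq {q t : ℝ} (hq : q ∈ Set.Icc (0 : ℝ) 3) (ht : q ^ 2 = t) :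
    √(30 + 2 * √(173 - 16 * q)) + √(30 + 2 * √(173 + 16 * q)) =
      √(60 + 2 * √(346 + 2 * √(29929 - 256 * t)) +
        2 * √(900 + 60 * √(346 + 2 * √(29929 - 256 * t)) + 4 * √(29929 - 256 * t))) := by
  have h1 : 0 ≤ 173 - 16 * q := by linarith [hq.2]
  have h2 : 0 ≤ 173 + 16 * q := by linarith [hq.1]
  have hw : √(173 - 16 * q) * √(173 + 16 * q) = √(29929 - 256 * t) := by
    rw [← Real.sqrt_mul h1]
    congr 1
    linear_combination -256 * ht
  have hv : √(173 - 16 * q) + √(173 + 16 * q) = √(346 + 2 * √(29929 - 256 * t)) := by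
    symm
    rw [Real.sqrt_eq_iff_eq_sq (by positivity) (by positivity), sq_sqrt_add_sqrt h1 h2,
      Real.sqrt_mul h1, hw]
    ring
  symm
  rw [Real.sqrt_eq_iff_eq_sq (by positivity) (by positivity),
    sq_sqrt_add_sqrt (by positivity) (by positivity), ← hv, ← hw]
  rw [show (30 + 2 * √(173 - 16 * q)) * (30 + 2 * √(173 + 16 * q)) =
    900 + 60 * (√(173 - 16 * q) + √(173 + 16 * q)) + 4 * (√(173 - 16 * q) * √(173 + 16 * q)) by
    ring]
  ring

theorem nested_sqrt_le {t : ℝ} (ht : t ∈ Set.Icc (0 : ℝ) 9) :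
    √(60 + 2 * √(346 + 2 * √(29929 - 256 * t)) +
        2 * √(900 + 60 * √(346 + 2 * √(29929 - 256 * t)) + 4 * √(29929 - 256 * t))) ≤
      14.99353 - 0.004705 * (t - 3) := by
  have hw := Real.sqrt_le_tangent (z := 29929 - 256 * t) (c := 170.766) (by linarith [ht.2])
    (by norm_num)
  set w := √(29929 - 256 * t)
  have hv := Real.sqrt_le_tangent (z := 346 + 2 * w) (c := 26.2208) (by positivity) (by norm_num)
  set v := √(346 + 2 * w)
  have hy := Real.sqrt_le_tangent (z := 900 + 60 * v + 4 * w) (c := 56.181) (by positivity)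
    (by norm_num)
  set y := √(900 + 60 * v + 4 * w)
  refine (Real.sqrt_le_tangent (c := 14.9935) (by positivity) (by norm_num)).trans ?_
  norm_num at hw hv hy ⊢
  linarith [ht.1, ht.2]

theorem le_nested_sqrt {t : ℝ} (ht : t ∈ Set.Icc (0 : ℝ) 9) :
    15.0074 - 0.00475 * t ≤
    √(60 + 2 * √(346 + 2 * √(29929 - 256 * t)) +
        2 * √(900 + 60 * √(346 + 2 * √(29929 - 256 * t)) + 4 * √(29929 - 256 * t))) := by
  obtain ⟨h0, h9⟩ := ht
  have hp : 0 ≤ t * (9 - t) := mul_nonneg h0 (by linarith)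
  have hw : 172.999 - 0.7547 * t ≤ √(29929 - 256 * t) := Real.le_sqrt_of_sq_le (by nlinarith)
  set w := √(29929 - 256 * t)
  have hv : 26.3058 - 0.02883 * t ≤ √(346 + 2 * w) := Real.le_sqrt_of_sq_le (by nlinarith)
  set v := √(346 + 2 * w)
  have hy : 56.3058 - 0.04232 * t ≤ √(900 + 60 * v + 4 * w) :=
    Real.le_sqrt_of_sq_le (by nlinarith)
  exact Real.le_sqrt_of_sq_le (by nlinarith)

theorem hexDensity_mem_Icc (x y : ℝ) : hexDensity x y ∈
    Set.Icc (15.0074 - 0.00475 * hexSymbol x y) (14.99353 - 0.004705 * (hexSymbol x y - 3)) := by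
  have ht : hexSymbol x y ∈ Set.Icc (0 : ℝ) 9 := ⟨hexSymbol_nonneg x y, hexSymbol_le x y⟩
  have hq : √(hexSymbol x y) ∈ Set.Icc (0 : ℝ) 3 :=
    ⟨Real.sqrt_nonneg _, (Real.sqrt_le_left (by norm_num)).2 (ht.2.trans (by norm_num))⟩
  have h : hexDensity x y = √(60 + 2 * √(346 + 2 * √(29929 - 256 * hexSymbol x y)) +
      2 * √(900 + 60 * √(346 + 2 * √(29929 - 256 * hexSymbol x y)) +
        4 * √(29929 - 256 * hexSymbol x y))) := by
    rw [← sqrt_add_sqrt_neg_eq hq (Real.sq_sqrt ht.1)]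
    have h1 := sqrt_add_sqrt_sub_eq (a := √(hexSymbol x y)) ⟨by linarith [hq.1], hq.2⟩
    have h2 := sqrt_add_sqrt_sub_eq (a := -√(hexSymbol x y))
      ⟨by linarith [hq.2], by linarith [hq.1]⟩
    simp only [mul_neg, ← sub_eq_add_neg, sub_neg_eq_add] at h2
    rw [← h1, ← h2, hexDensity, hexSymbol]
    ring
  rw [h]
  exact ⟨le_nested_sqrt ht, nested_sqrt_le ht⟩

theorem integral_affine_hexSymbol (a b : ℝ) :
    ∫ x in (0 : ℝ)..(2 * Real.pi), ∫ y in (0 : ℝ)..(2 * Real.pi), (a + b * hexSymbol x y) =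
      4 * Real.pi ^ 2 * (a + 3 * b) := by
  have h1 : ∀ x, ∫ y in (0 : ℝ)..(2 * Real.pi), (a + b * hexSymbol x y) =
      2 * Real.pi * (a + 3 * b) + 4 * Real.pi * b * Real.cos x := by
    intro x
    have h2 : ∀ y, a + b * hexSymbol x y = (a + 3 * b + 2 * b * Real.cos x) +
        (2 * b * (1 + Real.cos x) * Real.cos y - 2 * b * Real.sin x * Real.sin y) := by
      intro y; rw [hexSymbol, Real.cos_add]; ring
    simp only [h2]
    rw [intervalIntegral.integral_add (by simp)
      (Continuous.intervalIntegrable (by fun_prop) _ _), intervalIntegral.integral_sub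
      (Continuous.intervalIntegrable (by fun_prop) _ _)
      (Continuous.intervalIntegrable (by fun_prop) _ _), intervalIntegral.integral_const_mul,
      intervalIntegral.integral_const_mul, integral_cos, integral_sin,
      intervalIntegral.integral_const]
    simp
    ring
  simp only [h1]
  rw [intervalIntegral.integral_add (by simp)
      (Continuous.intervalIntegrable (by fun_prop) _ _),
      intervalIntegral.integral_const_mul (4 * Real.pi * b), integral_cos, intervalIntegral.integral_const]
  simp
  ring

theorem doubleIntegral_mono {f g : ℝ → ℝ → ℝ} (hf : Continuous fun p : ℝ × ℝ => f p.1 p.2)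
    (hg : Continuous fun p : ℝ × ℝ => g p.1 p.2) (h : ∀ x y, f x y ≤ g x y) {a : ℝ} (ha : 0 ≤ a) :
    ∫ x in (0 : ℝ)..a, ∫ y in (0 : ℝ)..a, f x y ≤ ∫ x in (0 : ℝ)..a, ∫ y in (0 : ℝ)..a, g x y := by
  refine intervalIntegral.integral_mono ha
    ((intervalIntegral.continuous_parametric_intervalIntegral_of_continuous' hf
      0 a).intervalIntegrable _ _)
    ((intervalIntegral.continuous_parametric_intervalIntegral_of_continuous' hg
      0 a).intervalIntegrable _ _) fun x => ?_
  exact intervalIntegral.integral_mono ha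
    ((hf.comp (Continuous.prodMk_right x)).intervalIntegrable _ _)
    ((hg.comp (Continuous.prodMk_right x)).intervalIntegrable _ _) (h x)

theorem continuous_affine_hexSymbol (a b : ℝ) :
    Continuous fun p : ℝ × ℝ => a + b * hexSymbol p.1 p.2 := by
  unfold hexSymbol
  fun_prop

theorem abs_energyLimit_sub_lt :
    |1 / (72 * Real.pi ^ 2) * (∫ x in (0 : ℝ)..(2 * Real.pi), ∫ y in (0 : ℝ)..(2 * Real.pi),
        hexDensity x y) + (√5 + √13 + 6) / 18 - 1.4908| < 0.00005 := by
  have hup := doubleIntegral_mono (g := fun x y => _ + _ * hexSymbol x y) continuous_hexDensity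
    (continuous_affine_hexSymbol (14.99353 + 0.004705 * 3) (-0.004705))
    (fun x y => (hexDensity_mem_Icc x y).2.trans_eq (by ring)) Real.two_pi_pos.le
  have hlo := doubleIntegral_mono (f := fun x y => _ + _ * hexSymbol x y)
    (continuous_affine_hexSymbol 15.0074 (-0.00475))
    continuous_hexDensity (fun x y => le_trans (by linarith) (hexDensity_mem_Icc x y).1)
    Real.two_pi_pos.le
  rw [integral_affine_hexSymbol] at hup hlo
  set I := ∫ x in (0 : ℝ)..(2 * Real.pi), ∫ y in (0 : ℝ)..(2 * Real.pi), hexDensity x y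
  have hpi : 0 < Real.pi ^ 2 := by positivity
  have h1 : 1 / (72 * Real.pi ^ 2) * I ≤ 14.99353 / 18 := by
    rw [one_div, inv_mul_le_iff₀ (by positivity)]
    linarith
  have h2 : 14.99315 / 18 ≤ 1 / (72 * Real.pi ^ 2) * I := by
    rw [one_div, le_inv_mul_iff₀ (by positivity)]
    linarith
  have h5 : √5 < 2.23607 := (Real.sqrt_lt' (by norm_num)).2 (by norm_num)
  have h13 : √13 < 3.60556 := (Real.sqrt_lt' (by norm_num)).2 (by norm_num)
  have h5' : 2.23606 < √5 := Real.lt_sqrt_of_sq_lt (by norm_num)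
  have h13' : 3.60555 < √13 := Real.lt_sqrt_of_sq_lt (by norm_num)
  rw [abs_lt]
  constructor <;> linarith

end Bounds

theorem theorem2p5 :
    ∃ L : ℝ,
      L = 1 / (72 * Real.pi ^ 2) *
            (∫ x in (0 : ℝ)..(2 * Real.pi), ∫ y in (0 : ℝ)..(2 * Real.pi),
              (√(15 + 2 * √(13 + 4 *
                  √(3 + 2 * Real.cos x + 2 * Real.cos y + 2 * Real.cos (x + y))))
              + √(15 + 2 * √(13 - 4 *
                  √(3 + 2 * Real.cos x + 2 * Real.cos y + 2 * Real.cos (x + y))))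
              + √(15 - 2 * √(13 + 4 *
                  √(3 + 2 * Real.cos x + 2 * Real.cos y + 2 * Real.cos (x + y))))
              + √(15 - 2 * √(13 - 4 *
                  √(3 + 2 * Real.cos x + 2 * Real.cos y + 2 * Real.cos (x + y))))))
          + (√5 + √13 + 6) / 18 ∧
      Tendsto (fun p : ℕ × ℕ =>
        graphEnergy (lattice3624Toroidal p.1 p.2) / (18 * (p.1 : ℝ) * (p.2 : ℝ))) atTop (𝓝 L) ∧
      Tendsto (fun p : ℕ × ℕ =>
        graphEnergy (lattice3624Cylindrical p.1 p.2) / (18 * (p.1 : ℝ) * (p.2 : ℝ))) atTop (𝓝 L) ∧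
      Tendsto (fun p : ℕ × ℕ =>
        graphEnergy (lattice3624Free p.1 p.2) / (18 * (p.1 : ℝ) * (p.2 : ℝ))) atTop (𝓝 L) ∧
      |L - 1.4908| < 0.00005 := by
  refine ⟨_, rfl, tendsto_graphEnergy_lattice3624Toroidal,
    tendsto_div_of_abs_sub_le (fun p => ?_) tendsto_graphEnergy_lattice3624Toroidal,
    tendsto_div_of_abs_sub_le (fun p => ?_) tendsto_graphEnergy_lattice3624Toroidal,
    abs_energyLimit_sub_lt⟩
  · refine (abs_graphEnergy_cylindrical_sub_le p.1 p.2).trans ?_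
    have : (0 : ℝ) ≤ 2 * (p.2 + 1) := by positivity
    linarith
  · refine (abs_sub_le _ (graphEnergy (lattice3624Cylindrical p.1 p.2)) _).trans ?_
    linarith [abs_graphEnergy_cylindrical_sub_le p.1 p.2, abs_graphEnergy_free_sub_le p.1 p.2]
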